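/- A quadrisection of a triangle is an unordered pair of perpendicular line segments, contained in the (closed) triangle, which divide it into four regions of equal area. Let $\Delta ABC$ be a scalene triangle in the Euclidean plane, labelled so that $|BC|<|AB|<|AC|$; thus $AB$ is its side of middle length and $AC$ its longest side. Then $\Delta ABC$ has exactly one quadrisection for which one of the four regions is a triangle with a side lying on $AB$, and it has no quadrisection for which one of the four regions is a triangle with a side lying on $AC$. -/

import Mathlib

open scoped RealInnerProductSpace

/-- The Euclidean plane. -/
abbrev Plane : Type := EuclideanSpace ℝ (Fin 2)

/-- The closed triangular region with vertices `A`, `B`, `C`. -/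
def triangleRegion (A B C : Plane) : Set Plane :=
  convexHull ℝ {A, B, C}

/-- The regions into which two sets `s₁`, `s₂` divide a set `T`: the connected components of
`T` with `s₁` and `s₂` removed. -/
def regions (T s₁ s₂ : Set Plane) : Set (Set Plane) :=
  {R | ∃ p ∈ T \ (s₁ ∪ s₂), R = connectedComponentIn (T \ (s₁ ∪ s₂)) p}

/-- `s₁` and `s₂` are non-degenerate perpendicular line segments. -/
def PerpendicularSegments (s₁ s₂ : Set Plane) : Prop :=
  ∃ X P Y Q : Plane, X ≠ P ∧ Y ≠ Q ∧ s₁ = segment ℝ X P ∧ s₂ = segment ℝ Y Q ∧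
    ⟪P - X, Q - Y⟫ = 0

/-- `s₁` and `s₂` are perpendicular segments in `T` that divide `T` into exactly four regions,
each of which has one fourth of the area of `T`. -/
structure IsQuadrisectingPair (T s₁ s₂ : Set Plane) : Prop where
  perpendicular : PerpendicularSegments s₁ s₂
  subset_left : s₁ ⊆ T
  subset_right : s₂ ⊆ T
  ncard_regions : (regions T s₁ s₂).ncard = 4
  area_eq : ∀ R ∈ regions T s₁ s₂, MeasureTheory.volume R = MeasureTheory.volume T / 4

/-- One of the regions is triangular (its closure is a non-degenerate triangle) and a side of
that triangle lies on the segment with end points `A`, `B`. -/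
def HasTriangularPartOn (T s₁ s₂ : Set Plane) (A B : Plane) : Prop :=
  ∃ R ∈ regions T s₁ s₂, ∃ X Y O : Plane, AffineIndependent ℝ ![X, Y, O] ∧
    closure R = triangleRegion X Y O ∧ X ∈ segment ℝ A B ∧ Y ∈ segment ℝ A B

/-- The unordered pair of segments `q` is a quadrisection of `T` with a triangular part on the
segment with end points `A`, `B`. -/
def IsQuadrisectionOn (T : Set Plane) (A B : Plane) (q : Sym2 (Set Plane)) : Prop :=
  ∃ s₁ s₂ : Set Plane, q = s(s₁, s₂) ∧ IsQuadrisectingPair T s₁ s₂ ∧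
    HasTriangularPartOn T s₁ s₂ A B

/-! A quadrisection is the trace of a cross: two perpendicular lines through a point `O` whose four
open quadrants each contain a quarter of the triangle. Each of the four regions has positive area,
so it contains the part of the triangle in some quadrant; counting makes this a bijection, and the
segments must be full chords (`IsQuadrisectingPair.exists_isCross`, with converse
`IsCross.isQuadrisectingPair`). A triangular region with side `XY` on `AB` has its third vertex at
`O` (`IsCross.axes_of_closedPart_eq`).

Write `BX = x * AB` and `AY = z * AB`. Both lines bisect the area; `XO` must cut off `B`, and `YO`
must cut off `A`. Together with the quarter `XYO` this determines `O` from `x` and `z` and leaves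
one relation, `IsQuarter` (`IsCross.isQuarter`; conversely `IsQuarter.isQuadrisectionOn`). By the
law of cosines, perpendicularity becomes `W * AB² = β * AC² + (1 - β) * BC²`, where `W` is
`baseWeight` and `β` is `balance` (`IsQuarter.inner_arms_eq_zero_iff`).

On the curve `IsQuarter` one has `0 ≤ β ≤ 1` and `W ≥ 1`. The right side is a convex combination of
`AC²` and `BC²`, so the base cannot be strictly longest. If the base is the middle side, left minus
right is `AB² - BC² > 0` at `β = 0` and `AB² - AC² < 0` at `β = 1`, so it vanishes somewhere. It
vanishes only once because `W` is concave in `β`: both `W` and `(β - 1/2)²` are quartics in `u = x +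
z - 1`, and `weightQuartic_tangent` makes `W` a concave nonincreasing function of the latter.
Finally `β` determines `x` and `z` (`IsQuarter.eq_of_balance_eq`). -/

theorem inner_plane (x y : Plane) : ⟪x, y⟫ = x 0 * y 0 + x 1 * y 1 := by
  simp [PiLp.inner_apply, Fin.sum_univ_two, mul_comm]

theorem plane_ext {x y : Plane} (h0 : x 0 = y 0) (h1 : x 1 = y 1) : x = y := by
  ext i
  fin_cases i
  · exact h0
  · exact h1

theorem eq_zero_of_inner_eq_zero {u v w : Plane} (hu : u ≠ 0) (hv : v ≠ 0) (huv : ⟪u, v⟫ = 0)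
    (h1 : ⟪u, w⟫ = 0) (h2 : ⟪v, w⟫ = 0) : w = 0 := by
  have hu' : ⟪u, u⟫ ≠ 0 := by simpa using hu
  have hv' : ⟪v, v⟫ ≠ 0 := by simpa using hv
  rw [inner_plane] at *
  have hd : u 0 * v 1 - u 1 * v 0 ≠ 0 := by
    intro h
    -- Lagrange's identity: for orthogonal vectors the squared determinant is the product of the
    -- squared norms.
    apply mul_ne_zero hu' hv'
    linear_combination (u 0 * v 1 - u 1 * v 0) * h + (u 0 * v 0 + u 1 * v 1) * huv
  apply plane_ext
  · exact (mul_eq_zero.1 (show (u 0 * v 1 - u 1 * v 0) * w 0 = 0 by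
      linear_combination v 1 * h1 - u 1 * h2)).resolve_left hd
  · exact (mul_eq_zero.1 (show (u 0 * v 1 - u 1 * v 0) * w 1 = 0 by
      linear_combination u 0 * h2 - v 0 * h1)).resolve_left hd

/-! ### Quadrants, chords and crosses; signs in `ℤˣ` index the four quadrants -/

/-- The open quadrant with apex `O` spanned by the orthogonal vectors `u` and `v`. -/
def quadrant (O u v : Plane) : Set Plane :=
  {Z | 0 < ⟪u, Z - O⟫ ∧ 0 < ⟪v, Z - O⟫}

/-- The part of `T` on the line through `O` orthogonal to `w`. -/
def cut (T : Set Plane) (O w : Plane) : Set Plane :=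
  {Z | Z ∈ T ∧ ⟪w, Z - O⟫ = 0}

/-- The perpendicular lines through `O` with directions `u` and `v` divide `T` into four parts
of equal area. -/
structure IsCross (T : Set Plane) (O u v : Plane) : Prop where
  left_ne : u ≠ 0
  right_ne : v ≠ 0
  inner_eq : ⟪u, v⟫ = 0
  area : ∀ i j : ℤˣ,
    MeasureTheory.volume (T ∩ quadrant O (i • u) (j • v)) = MeasureTheory.volume T / 4

theorem inner_units_smul (i : ℤˣ) (u w : Plane) : ⟪i • u, w⟫ = ((i : ℤ) : ℝ) * ⟪u, w⟫ := by
  rcases Int.units_eq_one_or i with rfl | rfl <;> simp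

theorem units_smul_ne_zero (i : ℤˣ) {u : Plane} (hu : u ≠ 0) : i • u ≠ 0 := by
  rcases Int.units_eq_one_or i with rfl | rfl <;> simpa

theorem exists_unit_mul_pos {a : ℝ} (ha : a ≠ 0) : ∃ i : ℤˣ, 0 < ((i : ℤ) : ℝ) * a := by
  rcases lt_or_gt_of_ne ha with h | h
  · exact ⟨-1, by simpa⟩
  · exact ⟨1, by simpa⟩

theorem unit_eq_of_mul_pos {i j : ℤˣ} {a : ℝ} (hi : 0 < ((i : ℤ) : ℝ) * a)
    (hj : 0 < ((j : ℤ) : ℝ) * a) : i = j := by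
  rcases Int.units_eq_one_or i with rfl | rfl <;> rcases Int.units_eq_one_or j with rfl | rfl <;>
    first | rfl | (exfalso; simp at hi hj; linarith)

theorem IsCross.units_smul {T : Set Plane} {O u v : Plane} (h : IsCross T O u v) (i j : ℤˣ) :
    IsCross T O (i • u) (j • v) where
  left_ne := units_smul_ne_zero i h.left_ne
  right_ne := units_smul_ne_zero j h.right_ne
  inner_eq := by
    rw [inner_units_smul, real_inner_comm, inner_units_smul, real_inner_comm, h.inner_eq]
    simp
  area k l := by
    rw [smul_smul, smul_smul]
    exact h.area _ _

theorem quadrant_comm (O u v : Plane) : quadrant O u v = quadrant O v u := by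
  ext Z
  exact and_comm

theorem IsCross.symm {T : Set Plane} {O u v : Plane} (h : IsCross T O u v) :
    IsCross T O v u where
  left_ne := h.right_ne
  right_ne := h.left_ne
  inner_eq := by rw [real_inner_comm, h.inner_eq]
  area i j := by
    rw [quadrant_comm]
    exact h.area _ _

theorem cut_units_smul (T : Set Plane) (O u : Plane) (i : ℤˣ) : cut T O (i • u) = cut T O u := by
  ext Z
  simp [cut, inner_units_smul]

theorem cut_smul (T : Set Plane) (O u : Plane) {r : ℝ} (hr : r ≠ 0) :
    cut T O (r • u) = cut T O u := by
  ext Z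
  simp [cut, real_inner_smul_left, hr]

theorem inner_combo (w O X Y : Plane) {a b : ℝ} (hab : a + b = 1) :
    ⟪w, a • X + b • Y - O⟫ = a * ⟪w, X - O⟫ + b * ⟪w, Y - O⟫ := by
  have : a • X + b • Y - O = a • (X - O) + b • (Y - O) := by
    rw [smul_sub, smul_sub]
    nth_rewrite 1 [← one_smul ℝ O]
    rw [← hab, add_smul]
    abel
  rw [this, inner_add_right, real_inner_smul_right, real_inner_smul_right]

theorem convex_quadrant (O u v : Plane) : Convex ℝ (quadrant O u v) := by
  intro X hX Y hY a b ha hb hab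
  have key : ∀ w, 0 < ⟪w, X - O⟫ → 0 < ⟪w, Y - O⟫ → 0 < ⟪w, a • X + b • Y - O⟫ := by
    intro w h1 h2
    rw [inner_combo _ _ _ _ hab]
    rcases ha.eq_or_lt with rfl | ha
    · have : b = 1 := by linarith
      simpa [this] using h2
    · have := mul_pos ha h1
      have := mul_nonneg hb h2.le
      linarith
  exact ⟨key u hX.1 hY.1, key v hX.2 hY.2⟩

theorem continuous_inner_sub (w O : Plane) : Continuous fun Z : Plane => ⟪w, Z - O⟫ := by
  fun_prop

theorem isOpen_quadrant (O u v : Plane) : IsOpen (quadrant O u v) :=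
  (isOpen_lt continuous_const (continuous_inner_sub u O)).inter
    (isOpen_lt continuous_const (continuous_inner_sub v O))

theorem volume_line (O : Plane) {w : Plane} (hw : w ≠ 0) :
    MeasureTheory.volume {Z : Plane | ⟪w, Z - O⟫ = 0} = 0 := by
  have h : {Z : Plane | ⟪w, Z - O⟫ = 0} = (AffineSubspace.mk' O (ℝ ∙ w)ᗮ : AffineSubspace ℝ Plane) := by
    ext Z
    simp [Submodule.mem_orthogonal_singleton_iff_inner_right]
  rw [h]
  apply MeasureTheory.Measure.addHaar_affineSubspace
  intro htop
  have : O + w ∈ AffineSubspace.mk' O (ℝ ∙ w)ᗮ := by rw [htop]; trivial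
  rw [AffineSubspace.mem_mk', Submodule.mem_orthogonal_singleton_iff_inner_right] at this
  simp [hw] at this

/-- The half-open segment from a point in the closure of a quadrant to a point of the quadrant
stays in the quadrant. -/
theorem combo_mem_quadrant {O u v X Y : Plane} (hX₁ : 0 ≤ ⟪u, X - O⟫) (hX₂ : 0 ≤ ⟪v, X - O⟫)
    (hY : Y ∈ quadrant O u v) {a b : ℝ} (ha : 0 ≤ a) (hb : 0 < b) (hab : a + b = 1) :
    a • X + b • Y ∈ quadrant O u v := by
  constructor
  · rw [inner_combo _ _ _ _ hab]
    have := mul_pos hb hY.1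
    positivity
  · rw [inner_combo _ _ _ _ hab]
    have := mul_pos hb hY.2
    positivity

theorem IsPreconnected.subset_quadrant {S : Set Plane} (hS : IsPreconnected S) {O u v p : Plane}
    (h₁ : ∀ Z ∈ S, ⟪u, Z - O⟫ ≠ 0) (h₂ : ∀ Z ∈ S, ⟪v, Z - O⟫ ≠ 0) (hp : p ∈ S)
    (hpq : p ∈ quadrant O u v) : S ⊆ quadrant O u v := by
  have key : ∀ w, (∀ Z ∈ S, ⟪w, Z - O⟫ ≠ 0) → 0 < ⟪w, p - O⟫ → ∀ Z ∈ S, 0 < ⟪w, Z - O⟫ := by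
    intro w hw hpw Z hZ
    by_contra! hle
    obtain ⟨Z', hZ', h0⟩ := hS.intermediate_value hZ hp (continuous_inner_sub w O).continuousOn
      ⟨hle, hpw.le⟩
    exact hw Z' hZ' h0
  exact fun Z hZ => ⟨key u h₁ hpq.1 Z hZ, key v h₂ hpq.2 Z hZ⟩

theorem exists_mem_quadrant_of_ne {O u v Z : Plane} (h₁ : ⟪u, Z - O⟫ ≠ 0) (h₂ : ⟪v, Z - O⟫ ≠ 0) :
    ∃ i j : ℤˣ, Z ∈ quadrant O (i • u) (j • v) := by
  obtain ⟨i, hi⟩ := exists_unit_mul_pos h₁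
  obtain ⟨j, hj⟩ := exists_unit_mul_pos h₂
  exact ⟨i, j, by rwa [inner_units_smul], by rwa [inner_units_smul]⟩

theorem eq_of_mem_quadrant {O u v Z : Plane} {i j k l : ℤˣ}
    (h : Z ∈ quadrant O (i • u) (j • v)) (h' : Z ∈ quadrant O (k • u) (l • v)) :
    i = k ∧ j = l := by
  obtain ⟨h1, h2⟩ := h
  obtain ⟨h3, h4⟩ := h'
  rw [inner_units_smul] at h1 h2 h3 h4
  exact ⟨unit_eq_of_mul_pos h1 h3, unit_eq_of_mul_pos h2 h4⟩

theorem exists_mem_quadrant_of_volume_ne_zero {R : Set Plane} {O u v : Plane} (hu : u ≠ 0)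
    (hv : v ≠ 0) (hR : MeasureTheory.volume R ≠ 0) :
    ∃ i j : ℤˣ, ∃ Z ∈ R, Z ∈ quadrant O (i • u) (j • v) := by
  by_contra! hcon
  apply hR
  refine MeasureTheory.measure_mono_null ?_
    (MeasureTheory.measure_union_null (volume_line O hu) (volume_line O hv))
  intro Z hZ
  by_contra hn
  simp only [Set.mem_union, Set.mem_ofPred_eq, not_or] at hn
  obtain ⟨i, j, hij⟩ := exists_mem_quadrant_of_ne hn.1 hn.2
  exact hcon i j Z hZ hij

theorem quadrant_subset_diff {T s₁ s₂ : Set Plane} {O u v : Plane}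
    (h₁ : ∀ Z ∈ s₁, ⟪v, Z - O⟫ = 0) (h₂ : ∀ Z ∈ s₂, ⟪u, Z - O⟫ = 0) (i j : ℤˣ) :
    T ∩ quadrant O (i • u) (j • v) ⊆ T \ (s₁ ∪ s₂) := by
  rintro Z ⟨hZ, hq1, hq2⟩
  rw [inner_units_smul] at hq1 hq2
  refine ⟨hZ, ?_⟩
  rintro (h | h)
  · rw [h₁ Z h] at hq2
    simp at hq2
  · rw [h₂ Z h] at hq1
    simp at hq1

theorem isPreconnected_inter_quadrant {T : Set Plane} (hT : Convex ℝ T) (O u v : Plane) :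
    IsPreconnected (T ∩ quadrant O u v) :=
  (hT.inter (convex_quadrant O u v)).isPreconnected

/-! ### From quadrisecting pairs to crosses -/

/-- Four regions of equal positive area, cut out by two segments on orthogonal lines, correspond
to the four quadrants. -/
theorem IsQuadrisectingPair.exists_region {T s₁ s₂ : Set Plane} (hT : Convex ℝ T)
    (hT0 : MeasureTheory.volume T ≠ 0) (h : IsQuadrisectingPair T s₁ s₂) {O u v : Plane}
    (hu : u ≠ 0) (hv : v ≠ 0)
    (h₁ : ∀ Z ∈ s₁, ⟪v, Z - O⟫ = 0) (h₂ : ∀ Z ∈ s₂, ⟪u, Z - O⟫ = 0) :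
    ∃ R : ℤˣ × ℤˣ → Set Plane, Function.Injective R ∧ (∀ i, R i ∈ regions T s₁ s₂) ∧
      ∀ i, (T ∩ quadrant O (i.1 • u) (i.2 • v)).Nonempty ∧
        T ∩ quadrant O (i.1 • u) (i.2 • v) ⊆ R i := by
  have hpos : ∀ R ∈ regions T s₁ s₂, MeasureTheory.volume R ≠ 0 := by
    intro R hR
    rw [h.area_eq R hR]
    simpa using hT0
  have hsub : ∀ R ∈ regions T s₁ s₂, R ⊆ T := by
    rintro R ⟨p, hp, rfl⟩
    exact (connectedComponentIn_subset _ _).trans Set.sdiff_subset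
  -- The two lines are null sets, so a region of positive area has a point off both of them.
  have hex : ∀ R : regions T s₁ s₂, ∃ i : ℤˣ × ℤˣ, ∃ Z ∈ (R : Set Plane),
      Z ∈ quadrant O (i.1 • u) (i.2 • v) := by
    rintro ⟨R, hR⟩
    obtain ⟨i, j, hij⟩ := exists_mem_quadrant_of_volume_ne_zero hu hv (hpos R hR)
    exact ⟨(i, j), hij⟩
  choose idx Z hZR hZq using hex
  have hcomp : ∀ R : regions T s₁ s₂,
      (R : Set Plane) = connectedComponentIn (T \ (s₁ ∪ s₂)) (Z R) := by
    intro R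
    have hZ := hZR R
    obtain ⟨p, hp, hRp⟩ := R.2
    rw [hRp] at hZ ⊢
    exact connectedComponentIn_eq hZ
  have hKR : ∀ R : regions T s₁ s₂,
      T ∩ quadrant O ((idx R).1 • u) ((idx R).2 • v) ⊆ (R : Set Plane) := by
    intro R
    rw [hcomp R]
    exact (isPreconnected_inter_quadrant hT _ _ _).subset_connectedComponentIn
      ⟨hsub R R.2 (hZR R), hZq R⟩ (quadrant_subset_diff h₁ h₂ _ _)
  have hinj : Function.Injective idx := by
    intro R R' hRR'
    have hmem : Z R' ∈ (R : Set Plane) := by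
      apply hKR R
      rw [hRR']
      exact ⟨hsub R' R'.2 (hZR R'), hZq R'⟩
    apply Subtype.ext
    rw [hcomp R']
    rw [hcomp R] at hmem ⊢
    exact connectedComponentIn_eq hmem
  -- An injection from four regions into four quadrants.
  have hbij : Function.Bijective idx := by
    have : Finite (regions T s₁ s₂) := by
      apply Set.finite_of_ncard_ne_zero
      rw [h.ncard_regions]
      norm_num
    refine hinj.bijective_of_nat_card_le ?_
    have : Nat.card (regions T s₁ s₂) = 4 := h.ncard_regions
    rw [this]
    simp
  let e := Equiv.ofBijective idx hbij
  have he : ∀ i, idx (e.symm i) = i := fun i => e.apply_symm_apply i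
  refine ⟨fun i => e.symm i, Subtype.val_injective.comp e.symm.injective,
    fun i => (e.symm i).2, fun i => ⟨⟨Z (e.symm i), hsub _ (e.symm i).2 (hZR _), ?_⟩, ?_⟩⟩
  · have := hZq (e.symm i)
    rwa [he] at this
  · have := hKR (e.symm i)
    rwa [he] at this

theorem regions_disjoint {T s₁ s₂ R R' : Set Plane} (hR : R ∈ regions T s₁ s₂)
    (hR' : R' ∈ regions T s₁ s₂) {Z : Plane} (hZ : Z ∈ R) (hZ' : Z ∈ R') : R = R' := by
  obtain ⟨p, hp, rfl⟩ := hR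
  obtain ⟨p', hp', rfl⟩ := hR'
  rw [connectedComponentIn_eq hZ, connectedComponentIn_eq hZ']

/-- A region exceeds its quadrant only by points of the two lines: any other point lies in some
quadrant, hence in the region of that quadrant, and distinct regions are disjoint. -/
theorem IsQuadrisectingPair.volume_inter_quadrant {T s₁ s₂ : Set Plane} (hT : Convex ℝ T)
    (hT0 : MeasureTheory.volume T ≠ 0) (h : IsQuadrisectingPair T s₁ s₂) {O u v : Plane}
    (hu : u ≠ 0) (hv : v ≠ 0)
    (h₁ : ∀ Z ∈ s₁, ⟪v, Z - O⟫ = 0) (h₂ : ∀ Z ∈ s₂, ⟪u, Z - O⟫ = 0) (i j : ℤˣ) :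
    MeasureTheory.volume (T ∩ quadrant O (i • u) (j • v)) = MeasureTheory.volume T / 4 := by
  obtain ⟨R, hRinj, hR, hRK⟩ := h.exists_region hT hT0 hu hv h₁ h₂
  rw [← h.area_eq _ (hR (i, j))]
  apply le_antisymm (MeasureTheory.measure_mono (hRK (i, j)).2)
  have hle : MeasureTheory.volume (R (i, j)) ≤ MeasureTheory.volume
      (T ∩ quadrant O (i • u) (j • v) ∪ ({Z | ⟪u, Z - O⟫ = 0} ∪ {Z | ⟪v, Z - O⟫ = 0})) := by
    apply MeasureTheory.measure_mono
    intro Z hZ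
    by_cases h1 : ⟪u, Z - O⟫ = 0
    · exact Or.inr (Or.inl h1)
    by_cases h2 : ⟪v, Z - O⟫ = 0
    · exact Or.inr (Or.inr h2)
    left
    have hZT : Z ∈ T := by
      obtain ⟨p, hp, hRp⟩ := hR (i, j)
      rw [hRp] at hZ
      exact (connectedComponentIn_subset _ _ hZ).1
    refine ⟨hZT, ?_⟩
    obtain ⟨k, l, hkl⟩ := exists_mem_quadrant_of_ne h1 h2
    have : (i, j) = (k, l) :=
      hRinj (regions_disjoint (hR _) (hR _) hZ ((hRK (k, l)).2 ⟨hZT, hkl⟩))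
    obtain ⟨rfl, rfl⟩ := Prod.mk.inj this
    exact hkl
  refine hle.trans ((MeasureTheory.measure_union_le _ _).trans ?_)
  rw [MeasureTheory.measure_union_null (volume_line O hu) (volume_line O hv), add_zero]

theorem segment_subset_diff {T s₁ s₂ : Set Plane} (hT : Convex ℝ T) {O u v Z p : Plane}
    (h₁ : ∀ Z ∈ s₁, ⟪v, Z - O⟫ = 0) (h₂ : ∀ Z ∈ s₂, ⟪u, Z - O⟫ = 0) {i j : ℤˣ}
    (hZ : Z ∈ T \ (s₁ ∪ s₂)) (hZu : 0 ≤ ⟪i • u, Z - O⟫) (hZv : 0 ≤ ⟪j • v, Z - O⟫)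
    (hp : p ∈ T ∩ quadrant O (i • u) (j • v)) : segment ℝ Z p ⊆ T \ (s₁ ∪ s₂) := by
  rintro W ⟨a, b, ha, hb, hab, rfl⟩
  rcases hb.eq_or_lt with rfl | hb
  · have : a = 1 := by linarith
    simpa [this] using hZ
  · exact quadrant_subset_diff h₁ h₂ i j
      ⟨hT hZ.1 hp.1 ha hb.le hab, combo_mem_quadrant hZu hZv hp.2 ha hb hab⟩

/-- A region contains every point of the closure of its quadrant that is not on the segments. -/
theorem mem_region {T s₁ s₂ R : Set Plane} (hT : Convex ℝ T) {O u v Z p : Plane}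
    (h₁ : ∀ Z ∈ s₁, ⟪v, Z - O⟫ = 0) (h₂ : ∀ Z ∈ s₂, ⟪u, Z - O⟫ = 0) {i j : ℤˣ}
    (hR : R ∈ regions T s₁ s₂) (hpR : p ∈ R)
    (hZ : Z ∈ T \ (s₁ ∪ s₂)) (hZu : 0 ≤ ⟪i • u, Z - O⟫) (hZv : 0 ≤ ⟪j • v, Z - O⟫)
    (hp : p ∈ T ∩ quadrant O (i • u) (j • v)) : Z ∈ R := by
  obtain ⟨q, hq, rfl⟩ := hR
  rw [connectedComponentIn_eq hpR]
  exact (convex_segment Z p).isPreconnected.subset_connectedComponentIn (right_mem_segment ℝ Z p)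
    (segment_subset_diff hT h₁ h₂ hZ hZu hZv hp) (left_mem_segment ℝ Z p)

theorem exists_combo_eq_zero {a b : ℝ} (ha : 0 < a) (hb : b < 0) :
    ∃ r s : ℝ, 0 < r ∧ 0 < s ∧ r + s = 1 ∧ r * a + s * b = 0 := by
  have : 0 < a - b := by linarith
  refine ⟨-b / (a - b), a / (a - b), by apply div_pos <;> linarith, by positivity, ?_, ?_⟩
  · field_simp
    ring
  · field_simp
    ring

/-- Join points of two quadrants that differ only in the sign of `v`: the segment crosses the axis
between them. -/
theorem exists_mem_halfaxis {T : Set Plane} (hT : Convex ℝ T) {O u v : Plane}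
    (hne : ∀ i j : ℤˣ, (T ∩ quadrant O (i • u) (j • v)).Nonempty) (i : ℤˣ) :
    ∃ Z ∈ T, ⟪v, Z - O⟫ = 0 ∧ 0 < ⟪i • u, Z - O⟫ := by
  obtain ⟨p, hpT, hp1, hp2⟩ := hne i 1
  obtain ⟨q, hqT, hq1, hq2⟩ := hne i (-1)
  rw [inner_units_smul] at hp2 hq2
  simp only [Units.val_one, Int.cast_one, one_mul, Units.val_neg, Int.cast_neg, neg_mul,
    Left.neg_pos_iff] at hp2 hq2
  obtain ⟨r, s, hr, hs, hrs, h0⟩ := exists_combo_eq_zero hp2 hq2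
  refine ⟨r • p + s • q, hT hpT hqT hr.le hs.le hrs, ?_, ?_⟩
  · rw [inner_combo _ _ _ _ hrs, h0]
  · rw [inner_combo _ _ _ _ hrs]
    positivity

theorem eq_of_inner_sub_eq_zero {O u v Z : Plane} (hu : u ≠ 0) (hv : v ≠ 0) (huv : ⟪u, v⟫ = 0)
    (h₁ : ⟪u, Z - O⟫ = 0) (h₂ : ⟪v, Z - O⟫ = 0) : Z = O :=
  sub_eq_zero.1 (eq_zero_of_inner_eq_zero hu hv huv h₁ h₂)

/-- `O` lies between points of opposite half-axes. The convex set is arbitrary because the lemma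
serves both for a segment of the pair and for `T` cut by an open half-plane. -/
theorem apex_mem {S : Set Plane} (hS : Convex ℝ S) {O u v : Plane}
    (hu : u ≠ 0) (hv : v ≠ 0) (huv : ⟪u, v⟫ = 0)
    (hax : ∀ i : ℤˣ, ∃ Z ∈ S, ⟪v, Z - O⟫ = 0 ∧ 0 < ⟪i • u, Z - O⟫) : O ∈ S := by
  obtain ⟨p, hpS, hpv, hpu⟩ := hax 1
  obtain ⟨q, hqS, hqv, hqu⟩ := hax (-1)
  rw [inner_units_smul] at hpu hqu
  simp only [Units.val_one, Int.cast_one, one_mul, Units.val_neg, Int.cast_neg, neg_mul,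
    Left.neg_pos_iff] at hpu hqu
  obtain ⟨r, s, hr, hs, hrs, h0⟩ := exists_combo_eq_zero hpu hqu
  have : r • p + s • q = O := by
    apply eq_of_inner_sub_eq_zero hu hv huv
    · rw [inner_combo _ _ _ _ hrs, h0]
    · rw [inner_combo _ _ _ _ hrs, hpv, hqv]
      ring
  rw [← this]
  exact hS hpS hqS hr.le hs.le hrs

/-- A point of the chord, other than `O`, missing from the segment would join the regions on its two
sides. The point `O` itself follows by convexity of the segment. -/
theorem IsQuadrisectingPair.eq_cut {T s₁ s₂ : Set Plane} (hT : Convex ℝ T)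
    (hT0 : MeasureTheory.volume T ≠ 0) (h : IsQuadrisectingPair T s₁ s₂) {O u v : Plane}
    (hu : u ≠ 0) (hv : v ≠ 0) (huv : ⟪u, v⟫ = 0)
    (h₁ : ∀ Z ∈ s₁, ⟪v, Z - O⟫ = 0) (h₂ : ∀ Z ∈ s₂, ⟪u, Z - O⟫ = 0) (hs₁ : Convex ℝ s₁) :
    s₁ = cut T O v := by
  obtain ⟨R, hRinj, hR, hRK⟩ := h.exists_region hT hT0 hu hv h₁ h₂
  have hoff : ∀ Z ∈ T, ⟪v, Z - O⟫ = 0 → ⟪u, Z - O⟫ ≠ 0 → Z ∈ s₁ := by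
    intro Z hZ hZv hZu
    by_contra hns
    have hZD : Z ∈ T \ (s₁ ∪ s₂) := ⟨hZ, by
      rintro (h | h)
      · exact hns h
      · exact hZu (h₂ Z h)⟩
    obtain ⟨i, hi⟩ := exists_unit_mul_pos hZu
    have hmem : ∀ j : ℤˣ, Z ∈ R (i, j) := by
      intro j
      obtain ⟨p, hp⟩ := (hRK (i, j)).1
      refine mem_region hT h₁ h₂ (hR (i, j)) ((hRK (i, j)).2 hp) hZD ?_ ?_ hp
      · rw [inner_units_smul]
        exact hi.le
      · rw [inner_units_smul, hZv, mul_zero]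
    have := hRinj (regions_disjoint (hR (i, 1)) (hR (i, -1)) (hmem 1) (hmem (-1)))
    simp at this
  apply Set.Subset.antisymm
  · exact fun Z hZ => ⟨h.subset_left hZ, h₁ Z hZ⟩
  · rintro Z ⟨hZ, hZv⟩
    by_cases hZu : ⟪u, Z - O⟫ = 0
    · rw [eq_of_inner_sub_eq_zero hu hv huv hZu hZv]
      refine apex_mem hs₁ hu hv huv fun i => ?_
      obtain ⟨W, hW, hWv, hWu⟩ := exists_mem_halfaxis hT (fun i j => (hRK (i, j)).1) i
      refine ⟨W, hoff W hW hWv ?_, hWv, hWu⟩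
      rw [inner_units_smul] at hWu
      exact right_ne_zero_of_mul hWu.ne'
    · exact hoff Z hZ hZv hZu

theorem regions_comm (T s₁ s₂ : Set Plane) : regions T s₁ s₂ = regions T s₂ s₁ := by
  simp only [regions, Set.union_comm]

theorem IsQuadrisectingPair.symm {T s₁ s₂ : Set Plane} (h : IsQuadrisectingPair T s₁ s₂) :
    IsQuadrisectingPair T s₂ s₁ where
  perpendicular := by
    obtain ⟨X, P, Y, Q, h1, h2, h3, h4, h5⟩ := h.perpendicular
    exact ⟨Y, Q, X, P, h2, h1, h4, h3, by rw [real_inner_comm, h5]⟩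
  subset_left := h.subset_right
  subset_right := h.subset_left
  ncard_regions := by rw [regions_comm, h.ncard_regions]
  area_eq := by
    rw [regions_comm]
    exact h.area_eq

theorem IsQuadrisectingPair.exists_isCross {T s₁ s₂ : Set Plane} (hT : Convex ℝ T)
    (hT0 : MeasureTheory.volume T ≠ 0) (h : IsQuadrisectingPair T s₁ s₂) :
    ∃ O u v, IsCross T O u v ∧ s₁ = cut T O v ∧ s₂ = cut T O u := by
  obtain ⟨X, P, Y, Q, hXP, hYQ, rfl, rfl, hperp⟩ := h.perpendicular
  set u := P - X with hu_def
  set v := Q - Y with hv_def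
  have hu : u ≠ 0 := sub_ne_zero.2 hXP.symm
  have hv : v ≠ 0 := sub_ne_zero.2 hYQ.symm
  have hvu : ⟪v, u⟫ = 0 := by rw [real_inner_comm, hperp]
  have huu : ⟪u, u⟫ ≠ 0 := by simpa using hu
  -- The projection of `Y` onto the line `XP` is where the two carrier lines meet; the segments are
  -- not assumed to intersect.
  obtain ⟨O, hO⟩ : ∃ O, O = X + (⟪u, Y - X⟫ / ⟪u, u⟫) • u := ⟨_, rfl⟩
  have hXO : ⟪v, X - O⟫ = 0 := by
    have : X - O = -((⟪u, Y - X⟫ / ⟪u, u⟫) • u) := by rw [hO]; abel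
    rw [this, inner_neg_right, real_inner_smul_right, hvu]
    simp
  have hPO : ⟪v, P - O⟫ = 0 := by
    have : P - O = u + (X - O) := by rw [hu_def]; abel
    rw [this, inner_add_right, hvu, hXO, add_zero]
  have hYO : ⟪u, Y - O⟫ = 0 := by
    have : Y - O = (Y - X) - (⟪u, Y - X⟫ / ⟪u, u⟫) • u := by rw [hO]; abel
    rw [this, inner_sub_right, real_inner_smul_right]
    field_simp
    ring
  have hQO : ⟪u, Q - O⟫ = 0 := by
    have : Q - O = v + (Y - O) := by rw [hv_def]; abel
    rw [this, inner_add_right, hperp, hYO, add_zero]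
  have hseg : ∀ {w A B : Plane}, ⟪w, A - O⟫ = 0 → ⟪w, B - O⟫ = 0 →
      ∀ Z ∈ segment ℝ A B, ⟪w, Z - O⟫ = 0 := by
    rintro w A B hA hB Z ⟨a, b, -, -, hab, rfl⟩
    rw [inner_combo _ _ _ _ hab, hA, hB]
    ring
  have h₁ := hseg hXO hPO
  have h₂ := hseg hYO hQO
  exact ⟨O, u, v, ⟨hu, hv, hperp, h.volume_inter_quadrant hT hT0 hu hv h₁ h₂⟩,
    h.eq_cut hT hT0 hu hv hperp h₁ h₂ (convex_segment _ _),
    h.symm.eq_cut hT hT0 hv hu hvu h₂ h₁ (convex_segment _ _)⟩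

/-! ### From crosses to quadrisecting pairs -/

theorem IsCross.nonempty {T : Set Plane} (hT0 : MeasureTheory.volume T ≠ 0) {O u v : Plane}
    (h : IsCross T O u v) (i j : ℤˣ) : (T ∩ quadrant O (i • u) (j • v)).Nonempty := by
  apply MeasureTheory.nonempty_of_measure_ne_zero (μ := MeasureTheory.volume)
  rw [h.area]
  simpa using hT0

theorem mem_diff_cut {T : Set Plane} {O u v Z : Plane} :
    Z ∈ T \ (cut T O v ∪ cut T O u) ↔ Z ∈ T ∧ ⟪u, Z - O⟫ ≠ 0 ∧ ⟪v, Z - O⟫ ≠ 0 := by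
  simp only [Set.mem_sdiff, Set.mem_union, cut, Set.mem_ofPred_eq]
  tauto

theorem IsCross.regions_eq {T : Set Plane} (hT : Convex ℝ T)
    (hT0 : MeasureTheory.volume T ≠ 0) {O u v : Plane} (h : IsCross T O u v) :
    regions T (cut T O v) (cut T O u) =
      Set.range fun i : ℤˣ × ℤˣ => T ∩ quadrant O (i.1 • u) (i.2 • v) := by
  have key : ∀ (i j : ℤˣ) (p : Plane), p ∈ T ∩ quadrant O (i • u) (j • v) →
      connectedComponentIn (T \ (cut T O v ∪ cut T O u)) p =
        T ∩ quadrant O (i • u) (j • v) := by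
    intro i j p hp
    have hsub := quadrant_subset_diff (T := T) (fun Z (hZ : Z ∈ cut T O v) => hZ.2)
      (fun Z (hZ : Z ∈ cut T O u) => hZ.2) i j
    apply Set.Subset.antisymm
    · apply Set.subset_inter ((connectedComponentIn_subset _ _).trans Set.sdiff_subset)
      refine isPreconnected_connectedComponentIn.subset_quadrant ?_ ?_
        (mem_connectedComponentIn (hsub hp)) hp.2
      · intro Z hZ
        rw [inner_units_smul]
        have := (mem_diff_cut.1 (connectedComponentIn_subset _ _ hZ)).2.1
        simpa
      · intro Z hZ
        rw [inner_units_smul]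
        have := (mem_diff_cut.1 (connectedComponentIn_subset _ _ hZ)).2.2
        simpa
    · exact (isPreconnected_inter_quadrant hT _ _ _).subset_connectedComponentIn hp hsub
  ext R
  constructor
  · rintro ⟨p, hp, rfl⟩
    have hp' := mem_diff_cut.1 hp
    obtain ⟨i, j, hij⟩ := exists_mem_quadrant_of_ne hp'.2.1 hp'.2.2
    exact ⟨(i, j), (key i j p ⟨hp'.1, hij⟩).symm⟩
  · rintro ⟨⟨i, j⟩, rfl⟩
    obtain ⟨p, hp⟩ := h.nonempty hT0 i j
    refine ⟨p, ?_, (key i j p hp).symm⟩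
    exact quadrant_subset_diff (fun Z (hZ : Z ∈ cut T O v) => hZ.2)
      (fun Z (hZ : Z ∈ cut T O u) => hZ.2) i j hp

theorem convex_cut {T : Set Plane} (hT : Convex ℝ T) (O w : Plane) : Convex ℝ (cut T O w) := by
  rintro X ⟨hX, hX'⟩ Y ⟨hY, hY'⟩ a b ha hb hab
  refine ⟨hT hX hY ha hb hab, ?_⟩
  rw [inner_combo _ _ _ _ hab, hX', hY']
  ring

theorem isCompact_cut {T : Set Plane} (hT : IsCompact T) (O w : Plane) :
    IsCompact (cut T O w) :=
  hT.inter_right (isClosed_eq (continuous_inner_sub w O) continuous_const)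

theorem inner_sub_sub (w O X Y : Plane) : ⟪w, X - Y⟫ = ⟪w, X - O⟫ - ⟪w, Y - O⟫ := by
  rw [← inner_sub_right, sub_sub_sub_cancel_right]

/-- The end points are the extreme points of the compact chord in direction `u`; they differ because
the chord meets both half-axes. -/
theorem IsCross.cut_eq_segment {T : Set Plane} (hTc : IsCompact T) (hT : Convex ℝ T)
    (hT0 : MeasureTheory.volume T ≠ 0) {O u v : Plane} (h : IsCross T O u v) :
    ∃ X P, X ≠ P ∧ cut T O v = segment ℝ X P ∧ ∃ r : ℝ, P - X = r • u := by
  obtain ⟨W, hW, hWv, hWu⟩ := exists_mem_halfaxis hT (h.nonempty hT0) 1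
  obtain ⟨V, hV, hVv, hVu⟩ := exists_mem_halfaxis hT (h.nonempty hT0) (-1)
  rw [inner_units_smul] at hWu hVu
  simp only [Units.val_one, Int.cast_one, one_mul, Units.val_neg, Int.cast_neg, neg_mul,
    Left.neg_pos_iff] at hWu hVu
  have hcont : ContinuousOn (fun Z => ⟪u, Z - O⟫) (cut T O v) :=
    (continuous_inner_sub u O).continuousOn
  obtain ⟨X, hX, hXmin⟩ := (isCompact_cut hTc O v).exists_isMinOn ⟨W, hW, hWv⟩ hcont
  obtain ⟨P, hP, hPmax⟩ := (isCompact_cut hTc O v).exists_isMaxOn ⟨W, hW, hWv⟩ hcont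
  have hXV : ⟪u, X - O⟫ ≤ ⟪u, V - O⟫ := hXmin ⟨hV, hVv⟩
  have hWP : ⟪u, W - O⟫ ≤ ⟪u, P - O⟫ := hPmax ⟨hW, hWv⟩
  have hlt : 0 < ⟪u, P - O⟫ - ⟪u, X - O⟫ := by linarith
  have huu : ⟪u, u⟫ ≠ 0 := by simpa using h.left_ne
  refine ⟨X, P, ?_, ?_, (⟪u, P - X⟫ / ⟪u, u⟫), ?_⟩
  · rintro rfl
    simp at hlt
  · apply Set.Subset.antisymm
    · intro Z hZ
      have h1 : ⟪u, X - O⟫ ≤ ⟪u, Z - O⟫ := hXmin hZ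
      have h2 : ⟪u, Z - O⟫ ≤ ⟪u, P - O⟫ := hPmax hZ
      set a := (⟪u, P - O⟫ - ⟪u, Z - O⟫) / (⟪u, P - O⟫ - ⟪u, X - O⟫) with ha
      set b := (⟪u, Z - O⟫ - ⟪u, X - O⟫) / (⟪u, P - O⟫ - ⟪u, X - O⟫) with hb
      have hab : a + b = 1 := by
        rw [ha, hb]
        field_simp
        ring
      refine ⟨a, b, div_nonneg (by linarith) hlt.le, div_nonneg (by linarith) hlt.le, hab, ?_⟩
      apply eq_of_inner_sub_eq_zero h.left_ne h.right_ne h.inner_eq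
      · rw [inner_sub_sub u O, inner_combo _ _ _ _ hab, ha, hb]
        field_simp
        ring
      · rw [inner_sub_sub v O, inner_combo _ _ _ _ hab, hX.2, hP.2, hZ.2]
        ring
    · exact (convex_cut hT O v).segment_subset hX hP
  · apply eq_of_inner_sub_eq_zero h.left_ne h.right_ne h.inner_eq
    · rw [inner_sub_right, real_inner_smul_right]
      field_simp
      ring
    · rw [inner_sub_right, real_inner_smul_right, h.symm.inner_eq, inner_sub_sub v O, hP.2, hX.2]
      ring

theorem IsCross.isQuadrisectingPair {T : Set Plane} (hTc : IsCompact T) (hT : Convex ℝ T)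
    (hT0 : MeasureTheory.volume T ≠ 0) {O u v : Plane} (h : IsCross T O u v) :
    IsQuadrisectingPair T (cut T O v) (cut T O u) where
  perpendicular := by
    obtain ⟨X, P, hXP, h1, r, hr⟩ := h.cut_eq_segment hTc hT hT0
    obtain ⟨Y, Q, hYQ, h2, s, hs⟩ := h.symm.cut_eq_segment hTc hT hT0
    refine ⟨X, P, Y, Q, hXP, hYQ, h1, h2, ?_⟩
    rw [hr, hs, real_inner_smul_left, real_inner_smul_right, h.inner_eq]
    ring
  subset_left _ hZ := hZ.1
  subset_right _ hZ := hZ.1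
  ncard_regions := by
    rw [h.regions_eq hT hT0, ← Set.image_univ, Set.ncard_image_of_injective, Set.ncard_univ]
    · simp
    · rintro ⟨i, j⟩ ⟨k, l⟩ hij
      obtain ⟨p, hp⟩ := h.nonempty hT0 i j
      have hp' := hp
      simp only at hij
      rw [hij] at hp'
      obtain ⟨rfl, rfl⟩ := eq_of_mem_quadrant hp.2 hp'.2
      rfl
  area_eq := by
    rw [h.regions_eq hT hT0]
    rintro R ⟨⟨i, j⟩, rfl⟩
    exact h.area i j

/-! ### Closed quadrants, triangles and their areas -/

/-- The part of `T` in the closed quadrant with apex `O` spanned by `u` and `v`. -/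
def closedPart (T : Set Plane) (O u v : Plane) : Set Plane :=
  {Z | Z ∈ T ∧ 0 ≤ ⟪u, Z - O⟫ ∧ 0 ≤ ⟪v, Z - O⟫}

/-- A point of the closed part is approached along the segment towards any point of the open part.
-/
theorem closure_inter_quadrant {T : Set Plane} (hTc : IsClosed T) (hT : Convex ℝ T)
    {O u v : Plane} (hne : (T ∩ quadrant O u v).Nonempty) :
    closure (T ∩ quadrant O u v) = closedPart T O u v := by
  apply Set.Subset.antisymm
  · apply closure_minimal
    · exact fun Z hZ => ⟨hZ.1, hZ.2.1.le, hZ.2.2.le⟩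
    · exact hTc.inter ((isClosed_le continuous_const (continuous_inner_sub u O)).inter
        (isClosed_le continuous_const (continuous_inner_sub v O)))
  · rintro Z ⟨hZ, hZu, hZv⟩
    obtain ⟨p, hpT, hpq⟩ := hne
    have hcont : Filter.Tendsto (fun t : ℝ => (1 - t) • Z + t • p) (nhdsWithin 0 (Set.Ioi 0))
        (nhds Z) := by
      have : Continuous fun t : ℝ => (1 - t) • Z + t • p := by fun_prop
      have := (this.tendsto 0).mono_left (nhdsWithin_le_nhds (s := Set.Ioi 0))
      simpa using this
    apply mem_closure_of_tendsto hcont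
    filter_upwards [Ioo_mem_nhdsGT (show (0 : ℝ) < 1 by norm_num)] with t ht
    exact ⟨hT hZ hpT (by linarith [ht.2]) ht.1.le (by ring),
      combo_mem_quadrant hZu hZv hpq (by linarith [ht.2]) ht.1 (by ring)⟩

/-- The determinant of two plane vectors. -/
def cross (u v : Plane) : ℝ :=
  u 0 * v 1 - u 1 * v 0

theorem mem_triangleRegion {X Y O Z : Plane} :
    Z ∈ triangleRegion X Y O ↔
      ∃ a b c : ℝ, 0 ≤ a ∧ 0 ≤ b ∧ 0 ≤ c ∧ a + b + c = 1 ∧ Z = a • X + b • Y + c • O := by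
  constructor
  · intro h
    rw [triangleRegion, convexHull_insert (Set.insert_nonempty _ _), convexHull_pair,
      convexJoin_singleton_left] at h
    simp only [Set.mem_iUnion] at h
    obtain ⟨W, ⟨b, c, hb, hc, hbc, rfl⟩, a, d, ha, hd, had, rfl⟩ := h
    refine ⟨a, d * b, d * c, ha, by positivity, by positivity, ?_, ?_⟩
    · linear_combination d * hbc + had
    · rw [smul_add, smul_smul, smul_smul, add_assoc]
  · rintro ⟨a, b, c, ha, hb, hc, habc, rfl⟩
    have := (convex_convexHull ℝ {X, Y, O}).sum_mem (t := Finset.univ) (w := ![a, b, c])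
      (z := ![X, Y, O]) (by intro i _; fin_cases i <;> simpa)
      (by simpa [Fin.sum_univ_three] using habc)
      (by intro i _; apply subset_convexHull; fin_cases i <;> simp)
    rw [triangleRegion]
    simpa [Fin.sum_univ_three] using this

theorem affineIndependent_iff_cross_ne_zero {A B C : Plane} :
    AffineIndependent ℝ ![A, B, C] ↔ cross (B - A) (C - A) ≠ 0 := by
  rw [affineIndependent_iff_not_collinear_set, not_iff_not,
    collinear_iff_of_mem (p₀ := A) (by simp)]
  simp only [Set.mem_insert_iff, Set.mem_singleton_iff, vadd_eq_add, forall_eq_or_imp, forall_eq]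
  constructor
  · rintro ⟨w, -, ⟨r, hr⟩, s, hs⟩
    rw [hr, hs]
    simp [cross]
    ring
  · intro h
    obtain ⟨u, hu⟩ : ∃ u, u = B - A := ⟨_, rfl⟩
    obtain ⟨v, hv⟩ : ∃ v, v = C - A := ⟨_, rfl⟩
    have hB : B = u + A := by rw [hu]; abel
    have hC : C = v + A := by rw [hv]; abel
    rw [← hu, ← hv, cross] at h
    by_cases h0 : u = 0
    · exact ⟨v, ⟨0, by simp⟩, ⟨0, by simp [hB, h0]⟩, 1, by simp [hC]⟩
    · refine ⟨u, ⟨0, by simp⟩, ⟨1, by simp [hB]⟩, ⟪u, v⟫ / ⟪u, u⟫, ?_⟩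
      have huu : ⟪u, u⟫ ≠ 0 := by simpa using h0
      have : v = (⟪u, v⟫ / ⟪u, u⟫) • u := by
        rw [inner_plane, inner_plane] at *
        apply plane_ext
        · simp only [PiLp.smul_apply, smul_eq_mul]
          rw [div_mul_eq_mul_div, eq_div_iff huu]
          linear_combination -u 1 * h
        · simp only [PiLp.smul_apply, smul_eq_mul]
          rw [div_mul_eq_mul_div, eq_div_iff huu]
          linear_combination u 0 * h
      rw [← this, hC]

/-- The linear map sending the standard basis to `u`, `v`. -/
noncomputable def frameMap (u v : Plane) : Plane →ₗ[ℝ] Plane where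
  toFun Z := Z 0 • u + Z 1 • v
  map_add' X Y := by
    simp only [PiLp.add_apply, add_smul]
    abel
  map_smul' r X := by
    simp only [PiLp.smul_apply, smul_eq_mul, mul_smul, smul_add, RingHom.id_apply]

theorem det_frameMap (u v : Plane) : LinearMap.det (frameMap u v) = cross u v := by
  rw [← LinearMap.det_toMatrix (EuclideanSpace.basisFun (Fin 2) ℝ).toBasis, Matrix.det_fin_two]
  simp [LinearMap.toMatrix_apply, frameMap, cross]
  ring

/-- The triangle spanned by the origin and the standard basis. -/
noncomputable def unitTriangle : Set Plane :=
  triangleRegion 0 (EuclideanSpace.single 0 1) (EuclideanSpace.single 1 1)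

theorem triangleRegion_eq_image (P Q R : Plane) :
    triangleRegion P Q R = (fun Z => P + Z) '' (frameMap (Q - P) (R - P) '' unitTriangle) := by
  ext Z
  rw [Set.image_image]
  simp only [Set.mem_image, unitTriangle, mem_triangleRegion]
  constructor
  · rintro ⟨a, b, c, ha, hb, hc, habc, rfl⟩
    refine ⟨_, ⟨a, b, c, ha, hb, hc, habc, rfl⟩, ?_⟩
    have : a = 1 - b - c := by linarith
    subst this
    simp [frameMap]
    module
  · rintro ⟨_, ⟨a, b, c, ha, hb, hc, habc, rfl⟩, rfl⟩
    refine ⟨a, b, c, ha, hb, hc, habc, ?_⟩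
    have : a = 1 - b - c := by linarith
    subst this
    simp [frameMap]
    module

/-- The area of `unitTriangle` can stay unevaluated, since only ratios of areas are needed. -/
theorem volume_triangleRegion (P Q R : Plane) :
    MeasureTheory.volume (triangleRegion P Q R) =
      ENNReal.ofReal |cross (Q - P) (R - P)| * MeasureTheory.volume unitTriangle := by
  rw [triangleRegion_eq_image, Set.image_add_left, MeasureTheory.measure_preimage_add,
    MeasureTheory.Measure.addHaar_image_linearMap, det_frameMap]

theorem isCompact_triangleRegion (P Q R : Plane) : IsCompact (triangleRegion P Q R) :=
  (Set.toFinite {P, Q, R}).isCompact_convexHull ℝ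

theorem convex_triangleRegion (P Q R : Plane) : Convex ℝ (triangleRegion P Q R) :=
  convex_convexHull ℝ _

theorem volume_triangleRegion_ne_zero {A B C : Plane} (h : AffineIndependent ℝ ![A, B, C]) :
    MeasureTheory.volume (triangleRegion A B C) ≠ 0 := by
  have hr : ({A, B, C} : Set Plane) = Set.range ![A, B, C] := by
    simp only [Matrix.range_cons, Matrix.range_empty, Set.union_empty, Set.singleton_union]
  have hspan : affineSpan ℝ ({A, B, C} : Set Plane) = ⊤ := by
    rw [hr]
    exact h.affineSpan_eq_top_iff_card_eq_finrank_add_one.2 (by simp)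
  have hne := interior_convexHull_nonempty_iff_affineSpan_eq_top.2 hspan
  exact (MeasureTheory.Measure.measure_pos_of_nonempty_interior _ hne).ne'

theorem volume_triangleRegion_ne_top (A B C : Plane) :
    MeasureTheory.volume (triangleRegion A B C) ≠ ⊤ :=
  (isCompact_triangleRegion A B C).measure_ne_top

/-- The ratio of the areas of two triangles is the ratio of their determinants. -/
theorem volume_triangleRegion_eq_mul {A B C P Q R : Plane} {r : ℝ}
    (h : cross (Q - P) (R - P) = r * cross (B - A) (C - A)) :
    MeasureTheory.volume (triangleRegion P Q R) =
      ENNReal.ofReal |r| * MeasureTheory.volume (triangleRegion A B C) := by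
  rw [volume_triangleRegion, volume_triangleRegion, h, abs_mul,
    ENNReal.ofReal_mul (abs_nonneg _), mul_assoc]

/-- The normal is `B - A` turned by a right angle and scaled by the determinant, so that its product
with `C - A` is a square. -/
theorem exists_normal {A B C : Plane} (h : AffineIndependent ℝ ![A, B, C]) :
    ∃ w : Plane, w ≠ 0 ∧ ⟪w, B - A⟫ = 0 ∧ 0 < ⟪w, C - A⟫ := by
  rw [affineIndependent_iff_cross_ne_zero] at h
  obtain ⟨u, hu⟩ : ∃ u, u = B - A := ⟨_, rfl⟩
  obtain ⟨v, hv⟩ : ∃ v, v = C - A := ⟨_, rfl⟩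
  rw [← hu, ← hv] at h ⊢
  have h1 : 0 < ⟪cross u v • (!₂[-u 1, u 0] : Plane), v⟫ := by
    have : ⟪cross u v • (!₂[-u 1, u 0] : Plane), v⟫ = cross u v ^ 2 := by
      rw [inner_plane]
      simp [cross]
      ring
    rw [this]
    exact lt_of_le_of_ne (sq_nonneg _) (pow_ne_zero 2 h).symm
  refine ⟨cross u v • !₂[-u 1, u 0], ?_, ?_, h1⟩
  · intro h0
    rw [h0] at h1
    simp at h1
  · rw [inner_plane]
    simp
    ring

theorem inner_combo₃ (w O X Y Z : Plane) {a b c : ℝ} (h : a + b + c = 1) :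
    ⟪w, a • X + b • Y + c • Z - O⟫ = a * ⟪w, X - O⟫ + b * ⟪w, Y - O⟫ + c * ⟪w, Z - O⟫ := by
  have : a • X + b • Y + c • Z - O = a • (X - O) + b • (Y - O) + c • (Z - O) := by
    have hc : c = 1 - a - b := by linarith
    subst hc
    module
  rw [this, inner_add_right, inner_add_right, real_inner_smul_right, real_inner_smul_right,
    real_inner_smul_right]

theorem quadrant_smul (O u v : Plane) {r s : ℝ} (hr : 0 < r) (hs : 0 < s) :
    quadrant O (r • u) (s • v) = quadrant O u v := by
  ext Z
  simp [quadrant, real_inner_smul_left, hr, hs]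

theorem units_smul_smul_comm (i : ℤˣ) (r : ℝ) (u : Plane) : i • (r • u) = r • (i • u) := by
  rcases Int.units_eq_one_or i with rfl | rfl <;> simp

theorem IsCross.smul {T : Set Plane} {O u v : Plane} (h : IsCross T O u v) {r s : ℝ}
    (hr : 0 < r) (hs : 0 < s) : IsCross T O (r • u) (s • v) where
  left_ne := smul_ne_zero hr.ne' h.left_ne
  right_ne := smul_ne_zero hs.ne' h.right_ne
  inner_eq := by
    rw [real_inner_smul_left, real_inner_smul_right, h.inner_eq]
    ring
  area i j := by
    rw [units_smul_smul_comm, units_smul_smul_comm, quadrant_smul _ _ _ hr hs]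
    exact h.area i j

/-! ### Vertices of the triangular part -/

/-- A nonnegative functional vanishing on a side is positive at the apex of a cross. -/
theorem IsCross.apex_pos {T : Set Plane} (hT : Convex ℝ T)
    (hT0 : MeasureTheory.volume T ≠ 0) {O u v A w : Plane} (h : IsCross T O u v) (hw : w ≠ 0)
    (hnn : ∀ Z ∈ T, 0 ≤ ⟪w, Z - A⟫) : O ∈ T ∧ 0 < ⟪w, O - A⟫ := by
  have hconv : Convex ℝ (T ∩ {Z | 0 < ⟪w, Z - A⟫}) := by
    apply hT.inter
    simpa [quadrant] using convex_quadrant A w w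
  -- Removing the line `w = 0` costs only a null set, so all four quadrants still meet the rest.
  refine apex_mem hconv h.left_ne h.right_ne h.inner_eq (exists_mem_halfaxis hconv fun i j => ?_)
  by_contra! hemp
  apply hT0
  have hnull : MeasureTheory.volume (T ∩ quadrant O (i • u) (j • v)) = 0 := by
    refine MeasureTheory.measure_mono_null (fun Z hZ => ?_) (volume_line A hw)
    by_contra hne
    have : Z ∈ T ∩ {Z | 0 < ⟪w, Z - A⟫} ∩ quadrant O (i • u) (j • v) :=
      ⟨⟨hZ.1, lt_of_le_of_ne (hnn Z hZ.1) (Ne.symm hne)⟩, hZ.2⟩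
    rw [hemp] at this
    exact this
  rw [h.area] at hnull
  simpa using hnull

theorem volume_closedPart {T : Set Plane} {O u v : Plane} (hu : u ≠ 0) (hv : v ≠ 0) :
    MeasureTheory.volume (closedPart T O u v) = MeasureTheory.volume (T ∩ quadrant O u v) := by
  apply le_antisymm
  · calc MeasureTheory.volume (closedPart T O u v)
        ≤ MeasureTheory.volume (T ∩ quadrant O u v ∪
            ({Z | ⟪u, Z - O⟫ = 0} ∪ {Z | ⟪v, Z - O⟫ = 0})) := by
          apply MeasureTheory.measure_mono
          rintro Z ⟨hZ, h1, h2⟩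
          rcases h1.eq_or_lt with h1 | h1
          · exact Or.inr (Or.inl h1.symm)
          rcases h2.eq_or_lt with h2 | h2
          · exact Or.inr (Or.inr h2.symm)
          exact Or.inl ⟨hZ, h1, h2⟩
      _ ≤ _ := by
          refine (MeasureTheory.measure_union_le _ _).trans ?_
          rw [MeasureTheory.measure_union_null (volume_line O hu) (volume_line O hv), add_zero]
  · exact MeasureTheory.measure_mono fun Z hZ => ⟨hZ.1, hZ.2.1.le, hZ.2.2.le⟩

theorem mem_triangleRegion_left (A B C : Plane) : A ∈ triangleRegion A B C :=
  subset_convexHull ℝ _ (by simp)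

theorem mem_triangleRegion_middle (A B C : Plane) : B ∈ triangleRegion A B C :=
  subset_convexHull ℝ _ (by simp)

theorem mem_triangleRegion_right (A B C : Plane) : C ∈ triangleRegion A B C :=
  subset_convexHull ℝ _ (by simp)

theorem triangleRegion_swap (A B C : Plane) : triangleRegion B A C = triangleRegion A B C := by
  rw [triangleRegion, triangleRegion, Set.insert_comm]

theorem exists_smul_eq {u v W : Plane} (hu : u ≠ 0) (hv : v ≠ 0) (huv : ⟪u, v⟫ = 0)
    (h₁ : ⟪v, W⟫ = 0) (h₂ : 0 < ⟪u, W⟫) : ∃ r : ℝ, 0 < r ∧ W = r • u := by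
  have huu : 0 < ⟪u, u⟫ := real_inner_self_pos.2 hu
  refine ⟨⟪u, W⟫ / ⟪u, u⟫, by positivity, sub_eq_zero.1 (eq_zero_of_inner_eq_zero hu hv huv ?_ ?_)⟩
  · rw [inner_sub_right, real_inner_smul_right]
    field_simp
    ring
  · rw [inner_sub_right, real_inner_smul_right, h₁, real_inner_comm u v, huv]
    ring

/-- Since `O` is off the line `XY`, it is a convex combination of `X`, `Y`, `O'` with positive
weight at `O'`. The functionals of `u` and `v` are nonnegative at these vertices and vanish at `O`,
hence at `O'`, so `O' = O`. Each half-axis contains a point of the triangle other than `O`; the same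
argument puts `X` or `Y` on it. -/
theorem IsCross.axes_of_closedPart_eq {T : Set Plane} (hT : Convex ℝ T)
    (hT0 : MeasureTheory.volume T ≠ 0) {O u v A w X Y O' : Plane} (h : IsCross T O u v)
    (hw : w ≠ 0) (hnn : ∀ Z ∈ T, 0 ≤ ⟪w, Z - A⟫) (hX : ⟪w, X - A⟫ = 0) (hY : ⟪w, Y - A⟫ = 0)
    (hK : closedPart T O u v = triangleRegion X Y O') :
    O' = O ∧ ((∃ r s : ℝ, 0 < r ∧ 0 < s ∧ X - O = r • u ∧ Y - O = s • v) ∨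
      ∃ r s : ℝ, 0 < r ∧ 0 < s ∧ Y - O = r • u ∧ X - O = s • v) := by
  obtain ⟨hOT, hOw⟩ := h.apex_pos hT hT0 hw hnn
  have hXK : X ∈ closedPart T O u v := hK ▸ mem_triangleRegion_left X Y O'
  have hYK : Y ∈ closedPart T O u v := hK ▸ mem_triangleRegion_middle X Y O'
  have hOK' : O' ∈ closedPart T O u v := hK ▸ mem_triangleRegion_right X Y O'
  have hvanish : ∀ {x y z : ℝ}, 0 ≤ x → 0 ≤ y → 0 ≤ z → x + y + z = 0 → x = 0 ∧ y = 0 ∧ z = 0 := by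
    intro x y z hx hy hz hs
    refine ⟨?_, ?_, ?_⟩ <;> linarith
  have hO'O : O' = O := by
    have hOK : O ∈ closedPart T O u v := ⟨hOT, by simp, by simp⟩
    rw [hK, mem_triangleRegion] at hOK
    obtain ⟨a, b, c, ha, hb, hc, habc, hO⟩ := hOK
    have hc' : c ≠ 0 := by
      rintro rfl
      rw [hO, inner_combo₃ _ _ _ _ _ habc, hX, hY] at hOw
      simp at hOw
    have key : ∀ x, 0 ≤ ⟪x, X - O⟫ → 0 ≤ ⟪x, Y - O⟫ → 0 ≤ ⟪x, O' - O⟫ → ⟪x, O' - O⟫ = 0 := by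
      intro x h1 h2 h3
      have h4 := inner_combo₃ x O X Y O' habc
      rw [← hO, sub_self, inner_zero_right] at h4
      have := (hvanish (mul_nonneg ha h1) (mul_nonneg hb h2) (mul_nonneg hc h3) h4.symm).2.2
      exact (mul_eq_zero.1 this).resolve_left hc'
    exact eq_of_inner_sub_eq_zero h.left_ne h.right_ne h.inner_eq
      (key u hXK.2.1 hYK.2.1 hOK'.2.1) (key v hXK.2.2 hYK.2.2 hOK'.2.2)
  refine ⟨hO'O, ?_⟩
  rw [hO'O] at hK
  have haxis : ∀ {x y : Plane}, 0 ≤ ⟪y, X - O⟫ → 0 ≤ ⟪y, Y - O⟫ →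
      (∃ Z ∈ triangleRegion X Y O, ⟪y, Z - O⟫ = 0 ∧ 0 < ⟪x, Z - O⟫) →
      (⟪y, X - O⟫ = 0 ∧ 0 < ⟪x, X - O⟫) ∨ (⟪y, Y - O⟫ = 0 ∧ 0 < ⟪x, Y - O⟫) := by
    rintro x y hX' hY' ⟨Z, hZ, h1, h2⟩
    obtain ⟨a, b, c, ha, hb, hc, habc, rfl⟩ := mem_triangleRegion.1 hZ
    rw [inner_combo₃ _ _ _ _ _ habc, sub_self, inner_zero_right, mul_zero] at h1 h2
    obtain ⟨h3, h4, -⟩ := hvanish (mul_nonneg ha hX') (mul_nonneg hb hY') le_rfl h1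
    by_cases hp : 0 < a * ⟪x, X - O⟫
    · left
      exact ⟨(mul_eq_zero.1 h3).resolve_left (left_ne_zero_of_mul hp.ne'),
        pos_of_mul_pos_right hp ha⟩
    · right
      have hq : 0 < b * ⟪x, Y - O⟫ := by linarith
      exact ⟨(mul_eq_zero.1 h4).resolve_left (left_ne_zero_of_mul hq.ne'),
        pos_of_mul_pos_right hq hb⟩
  have hax₁ := haxis (x := u) (y := v) hXK.2.2 hYK.2.2 (by
    obtain ⟨Z, hZ, h1, h2⟩ := exists_mem_halfaxis hT (h.nonempty hT0) 1
    rw [one_smul] at h2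
    exact ⟨Z, hK ▸ ⟨hZ, h2.le, h1.ge⟩, h1, h2⟩)
  have hax₂ := haxis (x := v) (y := u) hXK.2.1 hYK.2.1 (by
    obtain ⟨Z, hZ, h1, h2⟩ := exists_mem_halfaxis hT (h.symm.nonempty hT0) 1
    rw [one_smul] at h2
    exact ⟨Z, hK ▸ ⟨hZ, h1.ge, h2.le⟩, h1, h2⟩)
  have hscale : ∀ {Z : Plane}, ⟪v, Z - O⟫ = 0 ∧ 0 < ⟪u, Z - O⟫ → ∃ r : ℝ, 0 < r ∧ Z - O = r • u :=
    fun hZ => exists_smul_eq h.left_ne h.right_ne h.inner_eq hZ.1 hZ.2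
  have hscale' : ∀ {Z : Plane}, ⟪u, Z - O⟫ = 0 ∧ 0 < ⟪v, Z - O⟫ → ∃ r : ℝ, 0 < r ∧ Z - O = r • v :=
    fun hZ => exists_smul_eq h.right_ne h.left_ne h.symm.inner_eq hZ.1 hZ.2
  rcases hax₁ with h1 | h1 <;> rcases hax₂ with h2 | h2
  · exact absurd h2.1 h1.2.ne'
  · obtain ⟨r, hr, hr'⟩ := hscale h1
    obtain ⟨s, hs, hs'⟩ := hscale' h2
    exact Or.inl ⟨r, s, hr, hs, hr', hs'⟩
  · obtain ⟨r, hr, hr'⟩ := hscale h1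
    obtain ⟨s, hs, hs'⟩ := hscale' h2
    exact Or.inr ⟨r, s, hr, hs, hr', hs'⟩
  · exact absurd h2.1 h1.2.ne'

/-- A quadrisection with a triangular part on `AB` in terms of the vertices of that part. -/
theorem IsQuadrisectionOn.exists_vertices {A B C : Plane} (hABC : AffineIndependent ℝ ![A, B, C])
    {q : Sym2 (Set Plane)} (hq : IsQuadrisectionOn (triangleRegion A B C) A B q) :
    ∃ X Y O, X ∈ segment ℝ A B ∧ Y ∈ segment ℝ A B ∧ O ∈ triangleRegion A B C ∧
      IsCross (triangleRegion A B C) O (X - O) (Y - O) ∧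
      MeasureTheory.volume (triangleRegion X Y O) =
        MeasureTheory.volume (triangleRegion A B C) / 4 ∧
      q = s(cut (triangleRegion A B C) O (Y - O), cut (triangleRegion A B C) O (X - O)) := by
  obtain ⟨s₁, s₂, rfl, hpair, R, hR, X, Y, O', -, hRcl, hX, hY⟩ := hq
  have hT := convex_triangleRegion A B C
  have hT0 := volume_triangleRegion_ne_zero hABC
  obtain ⟨O, u, v, hcross, rfl, rfl⟩ := hpair.exists_isCross hT hT0
  rw [hcross.regions_eq hT hT0] at hR
  obtain ⟨⟨i, j⟩, rfl⟩ := hR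
  simp only at hRcl
  rw [closure_inter_quadrant (isCompact_triangleRegion A B C).isClosed hT
    (hcross.nonempty hT0 i j)] at hRcl
  obtain ⟨w, hw, hwB, hwC⟩ := exists_normal hABC
  have hnn : ∀ Z ∈ triangleRegion A B C, 0 ≤ ⟪w, Z - A⟫ := by
    intro Z hZ
    obtain ⟨a, b, c, ha, hb, hc, habc, rfl⟩ := mem_triangleRegion.1 hZ
    rw [inner_combo₃ _ _ _ _ _ habc, hwB, sub_self, inner_zero_right]
    simp only [mul_zero, zero_add]
    positivity
  have hseg : ∀ Z ∈ segment ℝ A B, ⟪w, Z - A⟫ = 0 := by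
    rintro Z ⟨a, b, -, -, hab, rfl⟩
    rw [inner_combo _ _ _ _ hab, hwB]
    simp
  have hcross' := hcross.units_smul i j
  have hvol : MeasureTheory.volume (triangleRegion X Y O') =
      MeasureTheory.volume (triangleRegion A B C) / 4 := by
    rw [← hRcl, volume_closedPart hcross'.left_ne hcross'.right_ne, hcross.area]
  obtain ⟨rfl, hax⟩ := hcross'.axes_of_closedPart_eq hT hT0 hw hnn (hseg X hX) (hseg Y hY) hRcl
  have hO := (hcross.apex_pos hT hT0 hw hnn).1
  rcases hax with ⟨r, s, hr, hs, hX', hY'⟩ | ⟨r, s, hr, hs, hY', hX'⟩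
  · refine ⟨X, Y, O', hX, hY, hO, ?_, hvol, ?_⟩
    · rw [hX', hY']
      exact hcross'.smul hr hs
    · rw [hX', hY', cut_smul _ _ _ hr.ne', cut_smul _ _ _ hs.ne', cut_units_smul, cut_units_smul]
  · refine ⟨Y, X, O', hY, hX, hO, ?_, ?_, ?_⟩
    · rw [hX', hY']
      exact hcross'.smul hr hs
    · rw [triangleRegion_swap, hvol]
    · rw [hX', hY', cut_smul _ _ _ hr.ne', cut_smul _ _ _ hs.ne', cut_units_smul, cut_units_smul]

/-! ### Lines bisecting a triangle -/

/-- The part of `T` in the closed half-plane bounded by the line through `O` orthogonal to `w`. -/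
def halfPart (T : Set Plane) (O w : Plane) : Set Plane :=
  {Z | Z ∈ T ∧ 0 ≤ ⟪w, Z - O⟫}

/-- A line separating the vertex `V` of a triangle from the other two cuts off a triangle. -/
theorem halfPart_triangleRegion {V W₁ W₂ O w : Plane} (hV : 0 < ⟪w, V - O⟫)
    (h₁ : ⟪w, W₁ - O⟫ ≤ 0) (h₂ : ⟪w, W₂ - O⟫ ≤ 0) :
    halfPart (triangleRegion V W₁ W₂) O w =
      triangleRegion V (V + (⟪w, V - O⟫ / (⟪w, V - O⟫ - ⟪w, W₁ - O⟫)) • (W₁ - V))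
        (V + (⟪w, V - O⟫ / (⟪w, V - O⟫ - ⟪w, W₂ - O⟫)) • (W₂ - V)) := by
  set f := ⟪w, V - O⟫
  set g₁ := ⟪w, W₁ - O⟫
  set g₂ := ⟪w, W₂ - O⟫
  have hf₁ : 0 < f - g₁ := by linarith
  have hf₂ : 0 < f - g₂ := by linarith
  ext Z
  simp only [halfPart, Set.mem_ofPred_eq, mem_triangleRegion]
  constructor
  · rintro ⟨⟨a, b, c, ha, hb, hc, habc, rfl⟩, hZ⟩
    rw [inner_combo₃ _ _ _ _ _ habc] at hZ
    change 0 ≤ a * f + b * g₁ + c * g₂ at hZ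
    refine ⟨(a * f + b * g₁ + c * g₂) / f, b * ((f - g₁) / f), c * ((f - g₂) / f),
      by positivity, by positivity, by positivity, ?_, ?_⟩
    · field_simp
      linear_combination f * habc
    · have ha' : a = 1 - b - c := by linarith
      have e₁ : b * ((f - g₁) / f) * (f / (f - g₁)) = b := by field_simp
      have e₂ : c * ((f - g₂) / f) * (f / (f - g₂)) = c := by field_simp
      have e₃ : (a * f + b * g₁ + c * g₂) / f = 1 - b * ((f - g₁) / f) - c * ((f - g₂) / f) := by
        rw [ha']
        field_simp
        ring
      rw [e₃, smul_add, smul_add, smul_smul, smul_smul, e₁, e₂, ha']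
      module
  · rintro ⟨a, b, c, ha, hb, hc, habc, rfl⟩
    set r := f / (f - g₁) with hr
    set s := f / (f - g₂) with hs
    have hr1 : r ≤ 1 := by
      rw [hr, div_le_one hf₁]
      linarith
    have hs1 : s ≤ 1 := by
      rw [hs, div_le_one hf₂]
      linarith
    have hr0 : 0 < r := by positivity
    have hs0 : 0 < s := by positivity
    have hsum : (a + b * (1 - r) + c * (1 - s)) + b * r + c * s = 1 := by linear_combination habc
    have hZ : a • V + b • (V + r • (W₁ - V)) + c • (V + s • (W₂ - V)) =
        (a + b * (1 - r) + c * (1 - s)) • V + (b * r) • W₁ + (c * s) • W₂ := by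
      module
    refine ⟨⟨_, b * r, c * s, ?_, by positivity, by positivity, hsum, hZ⟩, ?_⟩
    · have := mul_nonneg hb (sub_nonneg.2 hr1)
      have := mul_nonneg hc (sub_nonneg.2 hs1)
      positivity
    · rw [hZ, inner_combo₃ _ _ _ _ _ hsum]
      change 0 ≤ (a + b * (1 - r) + c * (1 - s)) * f + b * r * g₁ + c * s * g₂
      have e₁ : r * (f - g₁) = f := by
        rw [hr]
        field_simp
      have e₂ : s * (f - g₂) = f := by
        rw [hs]
        field_simp
      have : (a + b * (1 - r) + c * (1 - s)) * f + b * r * g₁ + c * s * g₂ = a * f := by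
        linear_combination -b * e₁ - c * e₂
      rw [this]
      positivity

theorem cross_smul_smul (r s : ℝ) (u v : Plane) : cross (r • u) (s • v) = r * s * cross u v := by
  simp [cross]
  ring

/-- The two factors are the fractions of the edges at `V` that the line cuts off, read from the zero
of the functional along each edge. -/
theorem volume_halfPart_triangleRegion {V W₁ W₂ O w : Plane} (hV : 0 < ⟪w, V - O⟫)
    (h₁ : ⟪w, W₁ - O⟫ ≤ 0) (h₂ : ⟪w, W₂ - O⟫ ≤ 0) :
    MeasureTheory.volume (halfPart (triangleRegion V W₁ W₂) O w) =
      ENNReal.ofReal (⟪w, V - O⟫ ^ 2 /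
        ((⟪w, V - O⟫ - ⟪w, W₁ - O⟫) * (⟪w, V - O⟫ - ⟪w, W₂ - O⟫))) *
        MeasureTheory.volume (triangleRegion V W₁ W₂) := by
  rw [halfPart_triangleRegion hV h₁ h₂]
  set f := ⟪w, V - O⟫
  set g₁ := ⟪w, W₁ - O⟫
  set g₂ := ⟪w, W₂ - O⟫
  have hf₁ : 0 < f - g₁ := by linarith
  have hf₂ : 0 < f - g₂ := by linarith
  rw [volume_triangleRegion_eq_mul (A := V) (B := W₁) (C := W₂)
    (r := f / (f - g₁) * (f / (f - g₂))), abs_of_pos (by positivity)]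
  · congr 2
    field_simp
  · rw [add_sub_cancel_left, add_sub_cancel_left, cross_smul_smul]

theorem measurableSet_quadrant (O u v : Plane) : MeasurableSet (quadrant O u v) :=
  (isOpen_quadrant O u v).measurableSet

/-- Up to a null set, a half-plane is the union of two quadrants. -/
theorem volume_halfPart {T : Set Plane} (hT : MeasurableSet T) {O u v : Plane}
    (hu : u ≠ 0) (hv : v ≠ 0) :
    MeasureTheory.volume (halfPart T O v) = MeasureTheory.volume (T ∩ quadrant O u v) +
      MeasureTheory.volume (T ∩ quadrant O (-u) v) := by
  rw [← MeasureTheory.measure_union]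
  · apply le_antisymm
    · calc MeasureTheory.volume (halfPart T O v)
          ≤ MeasureTheory.volume ((T ∩ quadrant O u v ∪ T ∩ quadrant O (-u) v) ∪
            ({Z | ⟪u, Z - O⟫ = 0} ∪ {Z | ⟪v, Z - O⟫ = 0})) := by
            apply MeasureTheory.measure_mono
            rintro Z ⟨hZ, h2⟩
            rcases h2.eq_or_lt with h2 | h2
            · exact Or.inr (Or.inr h2.symm)
            rcases lt_trichotomy ⟪u, Z - O⟫ 0 with h1 | h1 | h1
            · exact Or.inl (Or.inr ⟨hZ, by rw [inner_neg_left]; linarith, h2⟩)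
            · exact Or.inr (Or.inl h1)
            · exact Or.inl (Or.inl ⟨hZ, h1, h2⟩)
        _ ≤ _ := by
            refine (MeasureTheory.measure_union_le _ _).trans ?_
            rw [MeasureTheory.measure_union_null (volume_line O hu) (volume_line O hv), add_zero]
    · apply MeasureTheory.measure_mono
      rintro Z (⟨hZ, -, h⟩ | ⟨hZ, -, h⟩)
      · exact ⟨hZ, h.le⟩
      · exact ⟨hZ, h.le⟩
  · rw [Set.disjoint_left]
    rintro Z ⟨-, h1, -⟩ ⟨-, h2, -⟩
    rw [inner_neg_left] at h2
    linarith
  · exact hT.inter (measurableSet_quadrant _ _ _)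

theorem ENNReal_quarter_add_quarter (a : ENNReal) : a / 4 + a / 4 = a / 2 := by
  rw [← two_mul, div_eq_mul_inv, div_eq_mul_inv, mul_left_comm]
  congr 1
  rw [show (4 : ENNReal) = 2 * 2 by norm_num, ENNReal.mul_inv (by simp) (by simp), ← mul_assoc,
    ENNReal.mul_inv_cancel (by simp) (by simp), one_mul]

theorem IsCross.volume_halfPart {T : Set Plane} (hT : MeasurableSet T) {O u v : Plane}
    (h : IsCross T O u v) :
    MeasureTheory.volume (halfPart T O v) = MeasureTheory.volume T / 2 := by
  have h1 := h.area 1 1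
  have h2 := h.area (-1) 1
  rw [one_smul, one_smul] at h1
  rw [one_smul, show ((-1 : ℤˣ) • u) = -u by simp] at h2
  rw [_root_.volume_halfPart hT h.left_ne h.right_ne, h1, h2, ENNReal_quarter_add_quarter]

theorem ofReal_mul_eq_div_iff {r : ℝ} {a : ENNReal} (ha0 : a ≠ 0) (ha : a ≠ ⊤) {n : ℕ}
    (hn : n ≠ 0) : ENNReal.ofReal r * a = a / n ↔ r * n = 1 := by
  rw [ENNReal.eq_div_iff (by exact_mod_cast hn) (by simp), ← ENNReal.ofReal_natCast, ← mul_assoc,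
    ← ENNReal.ofReal_mul (by positivity)]
  nth_rewrite 2 [← one_mul a]
  rw [ENNReal.mul_left_inj ha0 ha, ENNReal.ofReal_eq_one, mul_comm]

/-- The condition that a line separating `V` from the other vertices bisects the triangle. -/
theorem volume_halfPart_eq_half_iff {V W₁ W₂ O w : Plane}
    (hne : AffineIndependent ℝ ![V, W₁, W₂]) (hV : 0 < ⟪w, V - O⟫)
    (h₁ : ⟪w, W₁ - O⟫ ≤ 0) (h₂ : ⟪w, W₂ - O⟫ ≤ 0) :
    MeasureTheory.volume (halfPart (triangleRegion V W₁ W₂) O w) =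
        MeasureTheory.volume (triangleRegion V W₁ W₂) / 2 ↔
      2 * ⟪w, V - O⟫ ^ 2 = (⟪w, V - O⟫ - ⟪w, W₁ - O⟫) * (⟪w, V - O⟫ - ⟪w, W₂ - O⟫) := by
  rw [volume_halfPart_triangleRegion hV h₁ h₂]
  have hf₁ : 0 < ⟪w, V - O⟫ - ⟪w, W₁ - O⟫ := by linarith
  have hf₂ : 0 < ⟪w, V - O⟫ - ⟪w, W₂ - O⟫ := by linarith
  have := ofReal_mul_eq_div_iff (n := 2) (volume_triangleRegion_ne_zero hne)
    (volume_triangleRegion_ne_top V W₁ W₂) (r := ⟪w, V - O⟫ ^ 2 /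
        ((⟪w, V - O⟫ - ⟪w, W₁ - O⟫) * (⟪w, V - O⟫ - ⟪w, W₂ - O⟫))) (by norm_num)
  push_cast at this
  rw [this, div_mul_eq_mul_div, div_eq_one_iff_eq (by positivity), mul_comm]

theorem IsCross.bisect {V W₁ W₂ O u v : Plane} (hne : AffineIndependent ℝ ![V, W₁, W₂])
    (h : IsCross (triangleRegion V W₁ W₂) O u v) (hV : 0 < ⟪v, V - O⟫) (h₁ : ⟪v, W₁ - O⟫ ≤ 0)
    (h₂ : ⟪v, W₂ - O⟫ ≤ 0) :
    2 * ⟪v, V - O⟫ ^ 2 = (⟪v, V - O⟫ - ⟪v, W₁ - O⟫) * (⟪v, V - O⟫ - ⟪v, W₂ - O⟫) :=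
  (volume_halfPart_eq_half_iff hne hV h₁ h₂).1
    (h.volume_halfPart (isCompact_triangleRegion V W₁ W₂).measurableSet)

theorem IsCross.neg_right {T : Set Plane} {O u v : Plane} (h : IsCross T O u v) :
    IsCross T O u (-v) := by
  simpa using h.units_smul 1 (-1)

/-- A bisecting line of a cross through a point of the side `AB` with parameter `p`, where the
functional has values `-p k`, `(1 - p) k` and `-M k` at `A`, `B`, `C`. -/
theorem IsCross.slope_eq {A B C O u v : Plane} (hne : AffineIndependent ℝ ![A, B, C])
    (h : IsCross (triangleRegion A B C) O u v) {p k M : ℝ} (hp1 : p < 1) (hk : 0 < k)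
    (hA : ⟪v, A - O⟫ = -p * k) (hB : ⟪v, B - O⟫ = (1 - p) * k) (hC : ⟪v, C - O⟫ = -M * k)
    (hp0 : 0 ≤ p) (hpM : M < 0 → 0 < p) :
    (0 ≤ M ∧ M = 2 * (1 - p) ^ 2 - (1 - p)) ∨ (M < 0 ∧ M = p - 2 * p ^ 2) := by
  -- The sign of `M` decides which vertex is cut off: `B` if `C` is not on its side, otherwise `A`.
  rcases le_or_gt 0 M with hM | hM
  · left
    rw [triangleRegion_swap B A C] at h
    have := h.bisect hne.comm_left (by rw [hB]; exact mul_pos (by linarith) hk)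
      (by rw [hA]; have := mul_nonneg hp0 hk.le; linarith)
      (by rw [hC]; have := mul_nonneg hM hk.le; linarith)
    rw [hA, hB, hC] at this
    refine ⟨hM, ?_⟩
    have h2 : k ^ 2 * (2 * (1 - p) ^ 2) = k ^ 2 * (1 - p + M) := by linear_combination this
    have := mul_left_cancel₀ (pow_ne_zero 2 hk.ne') h2
    linarith
  · right
    have hp := hpM hM
    have := h.neg_right.bisect hne
      (by rw [inner_neg_left, hA]; have := mul_pos hp hk; linarith)
      (by rw [inner_neg_left, hB]; have := mul_pos (sub_pos.2 hp1) hk; linarith)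
      (by rw [inner_neg_left, hC]; have := mul_pos (neg_pos.2 hM) hk; linarith)
    rw [inner_neg_left, inner_neg_left, inner_neg_left, hA, hB, hC] at this
    refine ⟨hM, ?_⟩
    have h2 : k ^ 2 * (2 * p ^ 2) = k ^ 2 * (p - M) := by linear_combination this
    have := mul_left_cancel₀ (pow_ne_zero 2 hk.ne') h2
    linarith

/-! ### Parameters of the triangular part -/

/-- The point with barycentric coordinates `(1 - s - t, s, t)`. -/
noncomputable def barycentric (A B C : Plane) (s t : ℝ) : Plane :=
  (1 - s - t) • A + s • B + t • C

theorem inner_barycentric (A B C w O : Plane) (s t : ℝ) :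
    ⟪w, barycentric A B C s t - O⟫ =
      (1 - s - t) * ⟪w, A - O⟫ + s * ⟪w, B - O⟫ + t * ⟪w, C - O⟫ :=
  inner_combo₃ _ _ _ _ _ (by ring)

theorem barycentric_sub (A B C : Plane) (s t s' t' : ℝ) :
    barycentric A B C s t - barycentric A B C s' t' =
      (s - s') • (B - A) + (t - t') • (C - A) := by
  rw [barycentric, barycentric]
  module

theorem cross_combo (a b c d : ℝ) (u v : Plane) :
    cross (a • u + b • v) (c • u + d • v) = (a * d - b * c) * cross u v := by
  simp [cross]
  ring

theorem volume_barycentric (A B C : Plane) {p q b c : ℝ} :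
    MeasureTheory.volume (triangleRegion (barycentric A B C p 0) (barycentric A B C q 0)
        (barycentric A B C b c)) =
      ENNReal.ofReal |(q - p) * c| * MeasureTheory.volume (triangleRegion A B C) := by
  apply volume_triangleRegion_eq_mul
  rw [barycentric_sub, barycentric_sub, cross_combo]
  ring

/-- The parameters `x`, `z` describe the end points on `AB` of two lines bisecting the triangle
that cut off a quarter of the triangle together with `AB`. -/
structure IsQuarter (x z : ℝ) : Prop where
  left_le : x ≤ 1
  right_le : z ≤ 1
  lt_add : 1 < x + z
  eq : 4 * (x + z - 1) ^ 2 = 2 * x ^ 2 + 2 * z ^ 2 - 1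

theorem half_lt_of_sub_sq_neg {p : ℝ} (hp : 0 ≤ p) (h : p - 2 * p ^ 2 < 0) : 1 / 2 < p := by
  by_contra! hle
  have := mul_nonneg hp (show 0 ≤ 1 - 2 * p by linarith)
  linarith [show p * (1 - 2 * p) = p - 2 * p ^ 2 by ring]

/-- The functional of `Y - O` vanishes at `X`, so it is known along `AB` up to scale; its zero at
`O` gives its value at `C`, and bisection fixes the slope `M`. The functional of `X - O` gives `N`
in the same way from the other end. -/
theorem IsCross.isQuarter {A B C : Plane} (hne : AffineIndependent ℝ ![A, B, C]) {p q b c : ℝ}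
    (hp : 0 ≤ p) (hpq : p < q) (hq : q ≤ 1) (hb : 0 ≤ b) (hc : 0 < c) (hbc : b + c ≤ 1)
    (hcross : IsCross (triangleRegion A B C) (barycentric A B C b c)
      (barycentric A B C p 0 - barycentric A B C b c)
      (barycentric A B C q 0 - barycentric A B C b c))
    (harea : (q - p) * c = 1 / 4) :
    IsQuarter (1 - p) q ∧ b - p = c * (2 * (1 - p) ^ 2 - 1) ∧ q - b = c * (2 * q ^ 2) := by
  set O := barycentric A B C b c with hO
  set X := barycentric A B C p 0 with hX
  set Y := barycentric A B C q 0 with hY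
  have hqp : 0 < q - p := sub_pos.2 hpq
  have hf : ∀ r w, ⟪w, barycentric A B C r 0 - O⟫ =
      (1 - r) * ⟪w, A - O⟫ + r * ⟪w, B - O⟫ := by
    intro r w
    rw [inner_barycentric]
    ring
  have hfO : ∀ w, (1 - b - c) * ⟪w, A - O⟫ + b * ⟪w, B - O⟫ + c * ⟪w, C - O⟫ = 0 := by
    intro w
    rw [← inner_barycentric, ← hO, sub_self, inner_zero_right]
  have hYY : 0 < ⟪Y - O, Y - O⟫ := real_inner_self_pos.2 hcross.right_ne
  have hXX : 0 < ⟪X - O, X - O⟫ := real_inner_self_pos.2 hcross.left_ne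
  have f1 := hf p (Y - O)
  have f2 := hf q (Y - O)
  have f3 := hfO (Y - O)
  have g1 := hf p (X - O)
  have g2 := hf q (X - O)
  have g3 := hfO (X - O)
  rw [← hX] at f1 g1
  rw [← hY] at f2 g2
  rw [hcross.symm.inner_eq] at f1
  rw [hcross.inner_eq] at g2
  obtain ⟨M, hM⟩ : ∃ M, M = (b * (1 - p) - (1 - b - c) * p) / c := ⟨_, rfl⟩
  obtain ⟨N, hN⟩ : ∃ N, N = ((1 - b - c) * q - b * (1 - q)) / c := ⟨_, rfl⟩
  have hMc : M * c = b * (1 - p) - (1 - b - c) * p := by rw [hM]; field_simp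
  have hNc : N * c = (1 - b - c) * q - b * (1 - q) := by rw [hN]; field_simp
  have hslope₁ := hcross.slope_eq hne (p := p) (k := ⟪Y - O, Y - O⟫ / (q - p)) (M := M)
    (by linarith) (by positivity)
    (by
      rw [mul_div_assoc', eq_div_iff hqp.ne']
      linear_combination p * f2 - q * f1)
    (by
      rw [mul_div_assoc', eq_div_iff hqp.ne']
      linear_combination -(1 - p) * f2 + (1 - q) * f1)
    (by
      rw [mul_div_assoc', eq_div_iff hqp.ne']
      apply mul_left_cancel₀ hc.ne'
      linear_combination (q - p) * f3 + ⟪Y - O, Y - O⟫ * hMc + (b * (1 - p) - (1 - b - c) * p) * f2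
        - (b * (1 - q) - (1 - b - c) * q) * f1)
    hp
    (by
      intro hM0
      by_contra! hp0
      have hp0 : p = 0 := le_antisymm hp0 hp
      rw [hp0] at hMc
      have := mul_neg_of_neg_of_pos hM0 hc
      linarith)
  rw [triangleRegion_swap B A C] at hcross
  have hslope₂ := hcross.symm.slope_eq hne.comm_left (p := 1 - q)
    (k := ⟪X - O, X - O⟫ / (q - p)) (M := N)
    (by linarith) (by positivity)
    (by
      rw [mul_div_assoc', eq_div_iff hqp.ne']
      linear_combination (1 - q) * g1 - (1 - p) * g2)
    (by
      rw [mul_div_assoc', eq_div_iff hqp.ne']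
      linear_combination -q * g1 + p * g2)
    (by
      rw [mul_div_assoc', eq_div_iff hqp.ne']
      apply mul_left_cancel₀ hc.ne'
      linear_combination (q - p) * g3 + ⟪X - O, X - O⟫ * hNc + ((1 - b - c) * q - b * (1 - q)) * g1
        - ((1 - b - c) * p - b * (1 - p)) * g2)
    (by linarith)
    (by
      intro hN0
      by_contra! hq0
      have hq0 : q = 1 := by linarith
      rw [hq0] at hNc
      have := mul_neg_of_neg_of_pos hN0 hc
      linarith)
  -- The area condition `harea` eliminates `c` from the sum of `hMc` and `hNc`.
  have hMN : 4 * (q - p) ^ 2 = M + N + q - p := by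
    have h1 : (M + N + (q - p)) * c = q - p := by linear_combination hMc + hNc
    have h2 : (4 * (q - p) ^ 2) * c = q - p := by linear_combination 4 * (q - p) * harea
    have := mul_right_cancel₀ hc.ne' (h1.trans h2.symm)
    linarith
  -- Only the case where `XO` cuts off `B` and `YO` cuts off `A` survives. In the mixed cases `q -
  -- p` cancels and a linear relation contradicts the bound by `1 / 2`; in the last case `q < 1 / 2
  -- < p`.
  rcases hslope₁ with ⟨hM0, hM1⟩ | ⟨hM0, hM1⟩ <;> rcases hslope₂ with ⟨hN0, hN1⟩ | ⟨hN0, hN1⟩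
  · refine ⟨⟨by linarith, hq, by linarith, ?_⟩, ?_, ?_⟩
    · rw [hM1, hN1] at hMN
      linear_combination hMN
    · linear_combination -hMc + c * hM1
    · linear_combination -hNc + c * hN1
  · exfalso
    have h1 : 1 / 2 < 1 - q := half_lt_of_sub_sq_neg (sub_nonneg.2 hq) (hN1 ▸ hN0)
    have h2 : (q - p) * (2 * (q - p) - (2 - p - q)) = 0 := by
      rw [hM1, hN1] at hMN
      linear_combination hMN / 2
    have := (mul_eq_zero.1 h2).resolve_left hqp.ne'
    linarith
  · exfalso
    have h1 : 1 / 2 < p := half_lt_of_sub_sq_neg hp (hM1 ▸ hM0)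
    have h2 : (q - p) * (2 * (q - p) - (q + p)) = 0 := by
      rw [hM1, hN1] at hMN
      linear_combination hMN / 2
    have := (mul_eq_zero.1 h2).resolve_left hqp.ne'
    linarith
  · exfalso
    have h1 : 1 / 2 < p := half_lt_of_sub_sq_neg hp (hM1 ▸ hM0)
    have h2 : 1 / 2 < 1 - q := half_lt_of_sub_sq_neg (sub_nonneg.2 hq) (hN1 ▸ hN0)
    linarith

/-- The apex of the triangular part with parameters `x`, `z`. -/
noncomputable def quarterApex (A B C : Plane) (x z : ℝ) : Plane :=
  barycentric A B C (1 - x + 1 / (4 * (x + z - 1)) * (2 * x ^ 2 - 1)) (1 / (4 * (x + z - 1)))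

/-- The first vertex on `AB` of the triangular part, as seen from the apex. -/
noncomputable def leftArm (A B C : Plane) (x z : ℝ) : Plane :=
  barycentric A B C (1 - x) 0 - quarterApex A B C x z

/-- The second vertex on `AB` of the triangular part, as seen from the apex. -/
noncomputable def rightArm (A B C : Plane) (x z : ℝ) : Plane :=
  barycentric A B C z 0 - quarterApex A B C x z

/-- The pair of chords through the apex along the arms. -/
noncomputable def quarterPair (A B C : Plane) (x z : ℝ) : Sym2 (Set Plane) :=
  s(cut (triangleRegion A B C) (quarterApex A B C x z) (rightArm A B C x z),
    cut (triangleRegion A B C) (quarterApex A B C x z) (leftArm A B C x z))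

theorem exists_barycentric_of_mem_segment {A B C X : Plane} (hX : X ∈ segment ℝ A B) :
    ∃ p : ℝ, 0 ≤ p ∧ p ≤ 1 ∧ X = barycentric A B C p 0 := by
  obtain ⟨a, b, ha, hb, hab, rfl⟩ := hX
  refine ⟨b, hb, by linarith, ?_⟩
  have : a = 1 - b := by linarith
  subst this
  simp [barycentric]

theorem barycentric_mem_segment {A B C : Plane} {p : ℝ} (h0 : 0 ≤ p) (h1 : p ≤ 1) :
    barycentric A B C p 0 ∈ segment ℝ A B :=
  ⟨1 - p, p, by linarith, h0, by ring, by simp [barycentric]⟩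

theorem exists_quarterPair_of_lt {A B C : Plane} (hABC : AffineIndependent ℝ ![A, B, C])
    {p q : ℝ} (hp : 0 ≤ p) (hq : q ≤ 1) (hpq : p < q) {O : Plane}
    (hO : O ∈ triangleRegion A B C)
    (hcross : IsCross (triangleRegion A B C) O (barycentric A B C p 0 - O)
      (barycentric A B C q 0 - O))
    (hvol : MeasureTheory.volume
        (triangleRegion (barycentric A B C p 0) (barycentric A B C q 0) O) =
      MeasureTheory.volume (triangleRegion A B C) / 4) :
    ∃ x z, IsQuarter x z ∧ ⟪leftArm A B C x z, rightArm A B C x z⟫ = 0 ∧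
      quarterPair A B C x z = s(cut (triangleRegion A B C) O (barycentric A B C q 0 - O),
        cut (triangleRegion A B C) O (barycentric A B C p 0 - O)) := by
  obtain ⟨a, b, c, ha, hb, hc, habc, rfl⟩ := mem_triangleRegion.1 hO
  have haeq : a = 1 - b - c := by linarith
  subst haeq
  change IsCross _ (barycentric A B C b c) (_ - barycentric A B C b c)
    (_ - barycentric A B C b c) at hcross
  change MeasureTheory.volume (triangleRegion _ _ (barycentric A B C b c)) = _ at hvol
  change ∃ x z, _ ∧ _ ∧ _ = s(cut _ (barycentric A B C b c) (_ - barycentric A B C b c),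
    cut _ (barycentric A B C b c) (_ - barycentric A B C b c))
  have hqp : 0 < q - p := sub_pos.2 hpq
  rw [volume_barycentric] at hvol
  have harea := (ofReal_mul_eq_div_iff (n := 4) (volume_triangleRegion_ne_zero hABC)
    (volume_triangleRegion_ne_top A B C) (by norm_num)).1 (by exact_mod_cast hvol)
  rw [abs_of_nonneg (by positivity)] at harea
  push_cast at harea
  have hc' : 0 < c := by
    rcases hc.eq_or_lt with rfl | h
    · simp at harea
    · exact h
  obtain ⟨hquart, h1, h2⟩ := hcross.isQuarter hABC hp hpq hq hb hc' (by linarith) (by linarith)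
  have hapex : quarterApex A B C (1 - p) q = barycentric A B C b c := by
    have hc1 : 1 / (4 * (1 - p + q - 1)) = c := by
      rw [div_eq_iff (by linarith)]
      linear_combination -harea
    rw [quarterApex, hc1]
    congr 1
    linear_combination -h1
  have hleft : leftArm A B C (1 - p) q = barycentric A B C p 0 - barycentric A B C b c := by
    rw [leftArm, hapex, sub_sub_cancel]
  have hright : rightArm A B C (1 - p) q = barycentric A B C q 0 - barycentric A B C b c := by
    rw [rightArm, hapex]
  refine ⟨1 - p, q, hquart, ?_, ?_⟩
  · rw [hleft, hright, hcross.inner_eq]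
  · rw [quarterPair, hleft, hright, hapex]

/-- Every quadrisection with a triangular part on `AB` comes from a pair of parameters. -/
theorem IsQuadrisectionOn.exists_quarterPair {A B C : Plane}
    (hABC : AffineIndependent ℝ ![A, B, C]) {q : Sym2 (Set Plane)}
    (hq : IsQuadrisectionOn (triangleRegion A B C) A B q) :
    ∃ x z, IsQuarter x z ∧ ⟪leftArm A B C x z, rightArm A B C x z⟫ = 0 ∧
      quarterPair A B C x z = q := by
  obtain ⟨X, Y, O, hX, hY, hO, hcross, hvol, rfl⟩ := hq.exists_vertices hABC
  obtain ⟨r, hr0, hr1, rfl⟩ := exists_barycentric_of_mem_segment (C := C) hX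
  obtain ⟨s, hs0, hs1, rfl⟩ := exists_barycentric_of_mem_segment (C := C) hY
  rcases lt_trichotomy r s with h | rfl | h
  · exact exists_quarterPair_of_lt hABC hr0 hs1 h hO hcross hvol
  · exfalso
    apply hcross.left_ne
    rw [← inner_self_eq_zero (𝕜 := ℝ), hcross.inner_eq]
  · rw [Sym2.eq_swap]
    rw [← triangleRegion_swap] at hvol
    exact exists_quarterPair_of_lt hABC hs0 hr1 h hO hcross.symm hvol

/-! ### Perpendicularity as a relation between side lengths -/

/-- The position of the triangular part along `AB`. -/
noncomputable def balance (x z : ℝ) : ℝ :=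
  1 / 2 + x ^ 2 - z ^ 2

/-- The weight of the squared base in the orthogonality condition. -/
noncomputable def baseWeight (x z : ℝ) : ℝ :=
  4 * x ^ 2 * z ^ 2 - x ^ 2 - z ^ 2 + 1 / 2

/-- `quarterApex` is placed by the line through the first vertex; the quadratic relation says that
it also fits the line through the second. -/
theorem IsQuarter.sub_eq {x z : ℝ} (h : IsQuarter x z) :
    z - (1 - x + 1 / (4 * (x + z - 1)) * (2 * x ^ 2 - 1)) =
      1 / (4 * (x + z - 1)) * (2 * z ^ 2) := by
  have h1 := h.lt_add
  have h2 : x + z - 1 ≠ 0 := by linarith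
  field_simp
  linear_combination h.eq

theorem leftArm_eq (A B C : Plane) (x z : ℝ) : leftArm A B C x z =
    (-(1 / (4 * (x + z - 1)))) • ((2 * x ^ 2 - 1) • (B - A) + (C - A)) := by
  rw [leftArm, quarterApex, barycentric_sub]
  module

theorem IsQuarter.rightArm_eq {x z : ℝ} (h : IsQuarter x z) (A B C : Plane) :
    rightArm A B C x z = (1 / (4 * (x + z - 1))) • ((2 * z ^ 2) • (B - A) - (C - A)) := by
  rw [rightArm, quarterApex, barycentric_sub, h.sub_eq]
  module

/-- The arms are orthogonal if and only if a balance of squared side lengths holds. -/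
theorem IsQuarter.inner_arms_eq_zero_iff {x z : ℝ} (h : IsQuarter x z) (A B C : Plane) :
    ⟪leftArm A B C x z, rightArm A B C x z⟫ = 0 ↔
      baseWeight x z * dist A B ^ 2 =
        balance x z * dist A C ^ 2 + (1 - balance x z) * dist B C ^ 2 := by
  have h1 := h.lt_add
  have hne : 1 / (4 * (x + z - 1)) ≠ 0 := by
    apply one_div_ne_zero
    linarith
  rw [leftArm_eq, h.rightArm_eq, real_inner_smul_left, real_inner_smul_right, mul_eq_zero,
    mul_eq_zero, or_iff_right (neg_ne_zero.2 hne), or_iff_right hne]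
  obtain ⟨e, he⟩ : ∃ e, e = B - A := ⟨_, rfl⟩
  obtain ⟨g, hg⟩ : ∃ g, g = C - A := ⟨_, rfl⟩
  have h1 : dist A B ^ 2 = ⟪e, e⟫ := by
    rw [dist_comm, dist_eq_norm, he, real_inner_self_eq_norm_sq]
  have h2 : dist A C ^ 2 = ⟪g, g⟫ := by
    rw [dist_comm, dist_eq_norm, hg, real_inner_self_eq_norm_sq]
  -- The law of cosines trades the mixed product `⟪e, g⟫` for squared sides.
  have h3 : dist B C ^ 2 = ⟪g, g⟫ - 2 * ⟪e, g⟫ + ⟪e, e⟫ := by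
    have : C - B = g - e := by rw [hg, he]; abel
    rw [dist_comm, dist_eq_norm, this, ← real_inner_self_eq_norm_sq, inner_sub_left,
      inner_sub_right, inner_sub_right, real_inner_comm e g]
    ring
  rw [h1, h2, h3, ← he, ← hg, inner_add_left, inner_sub_right, inner_sub_right,
    real_inner_smul_left, real_inner_smul_left, real_inner_smul_right, real_inner_smul_right,
    real_inner_comm e g, balance, baseWeight]
  constructor <;> intro h4 <;> linear_combination h4

/-! ### The parameter curve in terms of `u = x + z - 1` -/

theorem IsQuarter.swap {x z : ℝ} (h : IsQuarter x z) : IsQuarter z x :=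
  ⟨h.right_le, h.left_le, by linarith [h.lt_add], by linear_combination h.eq⟩

theorem IsQuarter.four_mul {x z : ℝ} (h : IsQuarter x z) :
    4 * (x * z) = 1 + 4 * (x + z - 1) - 2 * (x + z - 1) ^ 2 := by
  linear_combination h.eq

theorem IsQuarter.sub_sq {x z : ℝ} (h : IsQuarter x z) :
    (x - z) ^ 2 = 3 * (x + z - 1) ^ 2 - 2 * (x + z - 1) := by
  linear_combination -h.four_mul

/-- `u * (3 * u - 2) = (x - z)²` is nonnegative and `u > 0`. -/
theorem IsQuarter.two_thirds_le {x z : ℝ} (h : IsQuarter x z) : 2 / 3 ≤ x + z - 1 := by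
  have h1 : 0 < x + z - 1 := by linarith [h.lt_add]
  have h2 : 0 ≤ (x + z - 1) * (3 * (x + z - 1) - 2) := by
    have := sq_nonneg (x - z)
    rw [h.sub_sq] at this
    linarith
  have := nonneg_of_mul_nonneg_right h2 h1
  linarith

/-- On the curve, `4 * (1 - x) * (1 - z) = 1 - 2 * u²`. -/
theorem IsQuarter.two_mul_sq_le {x z : ℝ} (h : IsQuarter x z) : 2 * (x + z - 1) ^ 2 ≤ 1 := by
  have := mul_nonneg (sub_nonneg.2 h.left_le) (sub_nonneg.2 h.right_le)
  linarith [h.four_mul]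

/-- This bound and its mirror image place the apex inside the triangle. -/
theorem IsQuarter.le_two_mul_right_sq {x z : ℝ} (h : IsQuarter x z) : 1 ≤ 2 * z ^ 2 := by
  have h1 : 2 * z ^ 2 - 1 = (1 - x) * (2 * x + 8 * z - 6) := by
    linear_combination h.eq
  have h2 : 0 ≤ (1 - x) * (2 * x + 8 * z - 6) :=
    mul_nonneg (sub_nonneg.2 h.left_le) (by linarith [h.two_thirds_le, h.left_le])
  linarith

/-- The squared deviation of the balance from one half, in terms of `u = x + z - 1`. -/
noncomputable def balanceQuartic (u : ℝ) : ℝ :=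
  3 * u ^ 4 + 4 * u ^ 3 - u ^ 2 - 2 * u

/-- The base weight in terms of `u = x + z - 1`. -/
noncomputable def weightQuartic (u : ℝ) : ℝ :=
  u ^ 4 - 4 * u ^ 3 + u ^ 2 + 2 * u + 1 / 4

theorem IsQuarter.balance_sq {x z : ℝ} (h : IsQuarter x z) :
    (balance x z - 1 / 2) ^ 2 = balanceQuartic (x + z - 1) := by
  rw [balance, balanceQuartic]
  linear_combination (x + z) ^ 2 * h.sub_sq

theorem IsQuarter.baseWeight_eq {x z : ℝ} (h : IsQuarter x z) :
    baseWeight x z = weightQuartic (x + z - 1) := by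
  have h1 : baseWeight x z = (4 * (x * z)) ^ 2 / 4 - 2 * (x + z - 1) ^ 2 := by
    rw [baseWeight]
    linear_combination h.eq / 2
  rw [h1, h.four_mul, weightQuartic]
  ring

/-- `weightQuartic u - 1` has the factor `1 - 2 * u²`, which vanishes at the ends of the curve; the
cofactor is positive for `u ≥ 2 / 3`. -/
theorem IsQuarter.one_le_baseWeight {x z : ℝ} (h : IsQuarter x z) : 1 ≤ baseWeight x z := by
  rw [h.baseWeight_eq, weightQuartic]
  set u := x + z - 1
  have h1 : 0 ≤ 1 - 2 * u ^ 2 := by linarith [h.two_mul_sq_le]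
  have h2 : 0 ≤ (1 - 2 * u ^ 2) / 4 + 2 * u - 1 := by linarith [h.two_thirds_le]
  linarith [mul_nonneg h1 h2]

/-- `1 / 4 - balanceQuartic u` has the same factor `1 - 2 * u²`. -/
theorem IsQuarter.balance_mem {x z : ℝ} (h : IsQuarter x z) :
    0 ≤ balance x z ∧ balance x z ≤ 1 := by
  have h1 : (balance x z - 1 / 2) ^ 2 ≤ (1 / 2) ^ 2 := by
    rw [h.balance_sq, balanceQuartic]
    have h1 : 0 ≤ 1 - 2 * (x + z - 1) ^ 2 := by linarith [h.two_mul_sq_le]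
    have h2 : 0 ≤ 3 / 2 * (x + z - 1) ^ 2 + 2 * (x + z - 1) + 1 / 4 := by
      have := h.two_thirds_le
      positivity
    linarith [mul_nonneg h1 h2]
  have := abs_le.1 (abs_le_of_sq_le_sq h1 (by norm_num))
  exact ⟨by linarith [this.1], by linarith [this.2]⟩

/-- The weight quartic lies below its tangent as a function of the balance quartic. -/
theorem weightQuartic_tangent {u v : ℝ} (hu : 2 / 3 ≤ u) (hu' : 2 * u ^ 2 ≤ 1) (hv : 2 / 3 ≤ v)
    (hv' : 2 * v ^ 2 ≤ 1) :
    (v + 1) * (6 * v ^ 2 - 1) * (weightQuartic u - weightQuartic v) ≤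
      (1 + v - 6 * v ^ 2 + 2 * v ^ 3) * (balanceQuartic u - balanceQuartic v) := by
  -- `71 / 100` slightly exceeds `√(1 / 2)`, so `u` and `v` differ by less than `1 / 20`.
  have hmax : ∀ t : ℝ, 2 * t ^ 2 ≤ 1 → t ≤ 71 / 100 := by
    intro t ht
    by_contra! hlt
    linarith [mul_pos (sub_pos.2 hlt) (show 0 < t + 71 / 100 by linarith)]
  have hu2 := hmax u hu'
  have hv2 := hmax v hv'
  obtain ⟨s, hs⟩ : ∃ s, s = u - v := ⟨_, rfl⟩
  have hs1 : -(1 / 20) ≤ s := by linarith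
  have hs2 : s ≤ 1 / 20 := by linarith
  have hus : u = v + s := by linarith
  have hss : s ^ 2 ≤ 1 / 400 := by
    linarith [mul_nonneg (show 0 ≤ s + 1 / 20 by linarith) (show 0 ≤ 1 / 20 - s by linarith)]
  have hd : 25 / 9 ≤ (v + 1) * (6 * v ^ 2 - 1) := by
    have h1 : 4 / 9 ≤ v ^ 2 := by
      linarith [mul_nonneg (sub_nonneg.2 hv) (show 0 ≤ v + 2 / 3 by linarith)]
    linarith [mul_nonneg (show 0 ≤ v - 2 / 3 by linarith) (show 0 ≤ 6 * v ^ 2 - 1 by linarith)]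
  have hn : -(1 + v - 6 * v ^ 2 + 2 * v ^ 3) ≤ 61 / 100 := by
    nlinarith [mul_nonneg (sub_nonneg.2 hv) (sub_nonneg.2 hv2), sq_nonneg v]
  have hn0 : 0 ≤ -(1 + v - 6 * v ^ 2 + 2 * v ^ 3) := by
    nlinarith [mul_nonneg (sub_nonneg.2 hv) (sub_nonneg.2 hv2), sq_nonneg v]
  have hP1 : (6 * v ^ 2 - 12 * v + 1) + (4 * v - 4) * s + s ^ 2 ≤ -(42 / 10) := by
    have h1 := mul_nonneg (sub_nonneg.2 hv) (show 0 ≤ 4 / 3 - v by linarith)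
    have h2 := mul_nonneg (show 0 ≤ 1 - v by linarith) (show 0 ≤ s + 1 / 20 by linarith)
    linarith
  have hP2 : (18 * v ^ 2 + 12 * v - 1) + (12 * v + 4) * s + 3 * s ^ 2 ≤ 173 / 10 := by
    have h2 := mul_nonneg (show 0 ≤ 12 * v + 4 by linarith) (show 0 ≤ 1 / 20 - s by linarith)
    linarith
  -- The outer factors are half the derivatives of the two quartics at `v`, so the terms linear in
  -- `s` cancel and `s²` times this bracket remains. It is negative since `25/9 * 42/10 > 61/100 *
  -- 173/10`.
  have hQ : (v + 1) * (6 * v ^ 2 - 1) * ((6 * v ^ 2 - 12 * v + 1) + (4 * v - 4) * s + s ^ 2) +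
      -(1 + v - 6 * v ^ 2 + 2 * v ^ 3) *
        ((18 * v ^ 2 + 12 * v - 1) + (12 * v + 4) * s + 3 * s ^ 2) ≤ 0 := by
    have h1 := mul_le_mul_of_nonneg_left hP1 (show 0 ≤ (v + 1) * (6 * v ^ 2 - 1) by linarith)
    have h2 := mul_le_mul_of_nonneg_left hP2 hn0
    linarith
  have key := mul_nonpos_of_nonpos_of_nonneg hQ (sq_nonneg s)
  rw [hus, weightQuartic, weightQuartic, balanceQuartic, balanceQuartic]
  linarith

theorem slope_nonpos {v : ℝ} (hv : 2 / 3 ≤ v) (hv' : 2 * v ^ 2 ≤ 1) :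
    1 + v - 6 * v ^ 2 + 2 * v ^ 3 ≤ 0 := by
  nlinarith [mul_nonneg (sub_nonneg.2 hv) (sq_nonneg v)]

/-- The base weight is a concave function of the balance: it has supporting lines. -/
theorem IsQuarter.exists_supporting_slope {x z : ℝ} (h : IsQuarter x z) :
    ∃ s : ℝ, ∀ x' z', IsQuarter x' z' →
      baseWeight x' z' ≤ baseWeight x z + s * (balance x' z' - balance x z) := by
  set v := x + z - 1 with hv
  have hv1 := h.two_thirds_le
  rw [← hv] at hv1
  have hd : 0 < (v + 1) * (6 * v ^ 2 - 1) := by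
    apply mul_pos (by linarith)
    nlinarith
  set D := (1 + v - 6 * v ^ 2 + 2 * v ^ 3) / ((v + 1) * (6 * v ^ 2 - 1)) with hD
  have hD0 : D ≤ 0 := div_nonpos_of_nonpos_of_nonneg (slope_nonpos hv1 h.two_mul_sq_le) hd.le
  refine ⟨D * (2 * (balance x z - 1 / 2)), fun x' z' h' => ?_⟩
  have h1 := weightQuartic_tangent h'.two_thirds_le h'.two_mul_sq_le hv1 h.two_mul_sq_le
  rw [← h'.baseWeight_eq, ← h.baseWeight_eq, ← h'.balance_sq, ← h.balance_sq] at h1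
  have h2 : baseWeight x' z' - baseWeight x z ≤
      D * ((balance x' z' - 1 / 2) ^ 2 - (balance x z - 1 / 2) ^ 2) := by
    rw [hD, div_mul_eq_mul_div, le_div_iff₀ hd]
    linarith
  -- Linearising the square in the balance leaves the error `D * (balance x' z' - balance x z)²`,
  -- which is nonpositive because `D ≤ 0`.
  have h3 := mul_nonneg (neg_nonneg.2 hD0) (sq_nonneg (balance x' z' - balance x z))
  linarith

/-- The divided difference is positive for arguments at least `2 / 3`. -/
theorem balanceQuartic_injOn {u v : ℝ} (hu : 2 / 3 ≤ u) (hv : 2 / 3 ≤ v)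
    (h : balanceQuartic u = balanceQuartic v) : u = v := by
  rw [balanceQuartic, balanceQuartic] at h
  have h1 : (u - v) * (3 * (u + v) * (u ^ 2 + v ^ 2) + 4 * (u ^ 2 + u * v + v ^ 2) -
      (u + v) - 2) = 0 := by
    linear_combination h
  rcases mul_eq_zero.1 h1 with h2 | h2
  · linarith
  · exfalso
    have hu2 : 4 / 9 ≤ u ^ 2 := by nlinarith
    have hv2 : 4 / 9 ≤ v ^ 2 := by nlinarith
    have huv : 0 ≤ u * v := by positivity
    have := mul_nonneg (show 0 ≤ u + v by linarith) (show 0 ≤ u ^ 2 + v ^ 2 - 8 / 9 by linarith)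
    linarith

/-- The balance fixes `u`, hence `x + z`; then `x² - z²` gives `x - z`. -/
theorem IsQuarter.eq_of_balance_eq {x z x' z' : ℝ} (h : IsQuarter x z) (h' : IsQuarter x' z')
    (hb : balance x z = balance x' z') : x = x' ∧ z = z' := by
  have h1 : x + z - 1 = x' + z' - 1 := by
    apply balanceQuartic_injOn h.two_thirds_le h'.two_thirds_le
    rw [← h.balance_sq, ← h'.balance_sq, hb]
  have h2 : (x + z) * (x - z) = (x + z) * (x' - z') := by
    rw [balance, balance] at hb
    have h3 : x + z = x' + z' := by linarith
    linear_combination hb - (x' - z') * h3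
  have h3 : x - z = x' - z' := mul_left_cancel₀ (by linarith [h.lt_add]) h2
  exact ⟨by linarith, by linarith⟩

/-- This is the end of the curve with balance `0` and weight `1`, where the difference of the two
sides of the perpendicularity relation is `c - a`. -/
theorem isQuarter_left : IsQuarter √(1 / 2) 1 := by
  have h := Real.sq_sqrt (show (0 : ℝ) ≤ 1 / 2 by norm_num)
  have h0 : (0 : ℝ) < √(1 / 2) := Real.sqrt_pos.2 (by norm_num)
  exact ⟨Real.sqrt_le_one.2 (by norm_num), le_rfl, by linarith, by linear_combination 2 * h⟩

theorem balance_left : balance √(1 / 2) 1 = 0 := by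
  rw [balance, Real.sq_sqrt (by norm_num)]
  norm_num

theorem baseWeight_left : baseWeight √(1 / 2) 1 = 1 := by
  rw [baseWeight, Real.sq_sqrt (by norm_num)]
  norm_num

/-! ### Uniqueness, nonexistence and existence of orthogonal parameters -/

/-- The parameters of an orthogonal pair are unique if the base has middle length. -/
theorem IsQuarter.unique {x z x' z' a b c : ℝ} (h : IsQuarter x z) (h' : IsQuarter x' z')
    (hac : a < c) (hc : 0 < c)
    (he : baseWeight x z * c = balance x z * b + (1 - balance x z) * a)
    (he' : baseWeight x' z' * c = balance x' z' * b + (1 - balance x' z') * a) :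
    x = x' ∧ z = z' := by
  -- The difference of the two sides is concave in the balance and positive at balance `0`. Hence a
  -- supporting line at a zero has negative slope, and there is no zero further right.
  have key : ∀ {x z x' z' : ℝ}, IsQuarter x z → IsQuarter x' z' →
      baseWeight x z * c = balance x z * b + (1 - balance x z) * a →
      baseWeight x' z' * c = balance x' z' * b + (1 - balance x' z') * a →
      balance x' z' ≤ balance x z := by
    intro x z x' z' h h' he he'
    obtain ⟨s, hs⟩ := h.exists_supporting_slope
    have h1 := mul_le_mul_of_nonneg_right (hs _ _ isQuarter_left) hc.le
    have h2 := mul_le_mul_of_nonneg_right (hs x' z' h') hc.le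
    rw [balance_left, baseWeight_left] at h1
    have h3 : (s * c - b + a) * balance x z < 0 := by linarith
    have h4 : 0 ≤ (s * c - b + a) * (balance x' z' - balance x z) := by linarith
    have h5 := neg_of_mul_neg_left h3 h.balance_mem.1
    by_contra! hlt
    have := mul_neg_of_neg_of_pos h5 (sub_pos.2 hlt)
    linarith
  exact h.eq_of_balance_eq h' (le_antisymm (key h' h he' he) (key h h' he he'))

/-- There are no orthogonal pairs if the base is the longest side. -/
theorem IsQuarter.false_of_longest {x z a b c : ℝ} (h : IsQuarter x z) (hac : a < c) (hbc : b < c)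
    (hc : 0 < c) (he : baseWeight x z * c = balance x z * b + (1 - balance x z) * a) : False := by
  have h1 := mul_le_mul_of_nonneg_right h.one_le_baseWeight hc.le
  obtain ⟨h2, h3⟩ := h.balance_mem
  have h4 := mul_nonneg h2 (sub_pos.2 hbc).le
  have h5 := mul_nonneg (sub_nonneg.2 h3) (sub_pos.2 hac).le
  have h6 : balance x z * (c - b) = 0 := by linarith
  have h7 : (1 - balance x z) * (c - a) = 0 := by linarith
  have h8 := (mul_eq_zero.1 h6).resolve_right (sub_pos.2 hbc).ne'
  have h9 := (mul_eq_zero.1 h7).resolve_right (sub_pos.2 hac).ne'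
  linarith

/-- Orthogonal parameters exist if the base has middle length. -/
theorem exists_isQuarter {a b c : ℝ} (hac : a < c) (hcb : c < b) :
    ∃ x z, IsQuarter x z ∧
      baseWeight x z * c = balance x z * b + (1 - balance x z) * a := by
  set r : ℝ := √(1 / 2) with hr
  have hr2 : r ^ 2 = 1 / 2 := Real.sq_sqrt (by norm_num)
  have hr0 : 0 < r := Real.sqrt_pos.2 (by norm_num)
  have hr1 : r ≤ 1 := Real.sqrt_le_one.2 (by norm_num)
  have hdisc : ∀ x : ℝ, 0 < 3 * x ^ 2 - 4 * x + 3 / 2 := by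
    intro x
    linarith [sq_nonneg (x - 2 / 3)]
  -- The larger root `z` of the quadratic relation in `IsQuarter`; it runs from `1` at `x = r` to
  -- `r` at `x = 1`.
  set ζ : ℝ → ℝ := fun x => 2 * (1 - x) + √(3 * x ^ 2 - 4 * x + 3 / 2) with hζ
  set F : ℝ → ℝ := fun x =>
    baseWeight x (ζ x) * c - (balance x (ζ x) * b + (1 - balance x (ζ x)) * a) with hF
  have hcont : Continuous F := by
    rw [hF, hζ]
    unfold baseWeight balance
    fun_prop
  have hζr : ζ r = 1 := by
    have : 3 * r ^ 2 - 4 * r + 3 / 2 = (2 * r - 1) ^ 2 := by linear_combination -hr2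
    rw [hζ]
    simp only
    rw [this, Real.sqrt_sq]
    · ring
    · by_contra! hlt
      nlinarith
  have hζ1 : ζ 1 = r := by
    rw [hζ, hr]
    norm_num
  have hFr : F r = c - a := by
    simp only [hF, hζr, balance, baseWeight, hr2]
    ring
  have hF1 : F 1 = c - b := by
    simp only [hF, hζ1, balance, baseWeight, hr2]
    ring
  obtain ⟨x, ⟨hx0, hx1⟩, hx⟩ := intermediate_value_Icc' hr1 hcont.continuousOn
    (show (0 : ℝ) ∈ Set.Icc (F 1) (F r) by
      rw [hFr, hF1]
      constructor <;> linarith)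
  have hsq := Real.sq_sqrt (hdisc x).le
  have hpos := Real.sqrt_pos.2 (hdisc x)
  refine ⟨x, ζ x, ⟨hx1, ?_, ?_, ?_⟩, sub_eq_zero.1 hx⟩
  · have hx2 : r ^ 2 ≤ x ^ 2 := by gcongr
    have : √(3 * x ^ 2 - 4 * x + 3 / 2) ≤ 2 * x - 1 := by
      apply Real.sqrt_le_iff.2
      constructor
      · by_contra! hlt
        nlinarith
      · nlinarith
    simp only [hζ]
    linarith
  · simp only [hζ]
    linarith
  · simp only [hζ]
    linear_combination 2 * hsq

/-! ### From orthogonal parameters to a quadrisection -/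

theorem mem_triangleRegion_iff_barycentric {A B C Z : Plane} :
    Z ∈ triangleRegion A B C ↔
      ∃ s t : ℝ, 0 ≤ s ∧ 0 ≤ t ∧ s + t ≤ 1 ∧ Z = barycentric A B C s t := by
  rw [mem_triangleRegion]
  constructor
  · rintro ⟨a, b, c, ha, hb, hc, habc, rfl⟩
    refine ⟨b, c, hb, hc, by linarith, ?_⟩
    rw [barycentric, show a = 1 - b - c by linarith]
  · rintro ⟨s, t, hs, ht, hst, rfl⟩
    exact ⟨1 - s - t, s, t, by linarith, hs, ht, by ring, rfl⟩

/-- The part of a triangle cut off by two orthogonal rays from `O` to the base is a triangle. -/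
theorem closedPart_triangleRegion {A B C : Plane} {p q b c : ℝ} (hp : 0 ≤ p) (hpq : p < q)
    (hq : q ≤ 1) (hb : 0 ≤ b) (hc : 0 < c) (hbc : b + c ≤ 1) {X Y O : Plane}
    (hX : X = barycentric A B C p 0) (hY : Y = barycentric A B C q 0)
    (hO : O = barycentric A B C b c) (hXO : X - O ≠ 0) (hYO : Y - O ≠ 0)
    (hperp : ⟪X - O, Y - O⟫ = 0) :
    closedPart (triangleRegion A B C) O (X - O) (Y - O) = triangleRegion X Y O := by
  have hqp : 0 < q - p := sub_pos.2 hpq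
  have hYY : 0 < ⟪Y - O, Y - O⟫ := real_inner_self_pos.2 hYO
  have hXX : 0 < ⟪X - O, X - O⟫ := real_inner_self_pos.2 hXO
  have hperp' : ⟪Y - O, X - O⟫ = 0 := by rw [real_inner_comm, hperp]
  apply Set.Subset.antisymm
  · rintro Z ⟨hZ, hZX, hZY⟩
    obtain ⟨s, t, hs, ht, hst, rfl⟩ := mem_triangleRegion_iff_barycentric.1 hZ
    -- `1 - β - γ`, `β`, `γ` are the barycentric coordinates of the point with respect to `X`, `Y`,
    -- `O`.
    obtain ⟨γ, hγ⟩ : ∃ γ, γ = t / c := ⟨_, rfl⟩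
    obtain ⟨β, hβ⟩ : ∃ β, β = (s - b * γ - p * (1 - γ)) / (q - p) := ⟨_, rfl⟩
    have hγc : γ * c = t := by rw [hγ]; field_simp
    have hβq : β * (q - p) = s - b * γ - p * (1 - γ) := by rw [hβ]; field_simp
    have hsum : (1 - β - γ) + β + γ = 1 := by ring
    have hZ' : barycentric A B C s t = (1 - β - γ) • X + β • Y + γ • O := by
      have hs' : s = β * (q - p) + b * γ + p * (1 - γ) := by linarith
      rw [hX, hY, hO, ← hγc, hs']
      simp only [barycentric]
      module
    -- By orthogonality the two functionals isolate the coordinates at `X` and `Y`, up to a positive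
    -- squared norm.
    rw [hZ', inner_combo₃ _ _ _ _ _ hsum, sub_self, inner_zero_right] at hZX hZY
    rw [hperp] at hZX
    rw [hperp'] at hZY
    rw [hZ', mem_triangleRegion]
    refine ⟨_, β, γ, ?_, ?_, ?_, hsum, rfl⟩
    · exact nonneg_of_mul_nonneg_left (b := ⟪X - O, X - O⟫) (by linarith) hXX
    · exact nonneg_of_mul_nonneg_left (b := ⟪Y - O, Y - O⟫) (by linarith) hYY
    · rw [hγ]
      positivity
  · apply convexHull_min
    · have hT : ∀ {s t : ℝ}, 0 ≤ s → 0 ≤ t → s + t ≤ 1 →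
          barycentric A B C s t ∈ triangleRegion A B C := fun hs ht hst =>
        mem_triangleRegion_iff_barycentric.2 ⟨_, _, hs, ht, hst, rfl⟩
      rintro Z (rfl | rfl | rfl)
      · exact ⟨by rw [hX]; exact hT hp le_rfl (by linarith), hXX.le, hperp'.ge⟩
      · exact ⟨by rw [hY]; exact hT (by linarith) le_rfl (by linarith), hperp.ge, hYY.le⟩
      · exact ⟨by rw [hO]; exact hT hb hc.le hbc, by simp, by simp⟩
    · have hhalf : ∀ w : Plane, Convex ℝ {Z | 0 ≤ ⟪w, Z - O⟫} := by
        intro w Z hZ W hW a b ha hb hab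
        simp only [Set.mem_ofPred_eq] at hZ hW ⊢
        rw [inner_combo _ _ _ _ hab]
        positivity
      exact (convex_triangleRegion A B C).inter ((hhalf _).inter (hhalf _))

/-- A line through a point of the side `AB` with parameter `p` bisects the triangle if the
functional defining it has the values `-p k`, `(1 - p) k` and `-M k` at `A`, `B`, `C`. -/
theorem volume_halfPart_of_slope {A B C O v : Plane} (hne : AffineIndependent ℝ ![A, B, C])
    {p k M : ℝ} (hp0 : 0 ≤ p) (hp1 : p < 1) (hk : 0 < k) (hM0 : 0 ≤ M)
    (hM : M = 2 * (1 - p) ^ 2 - (1 - p))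
    (hA : ⟪v, A - O⟫ = -p * k) (hB : ⟪v, B - O⟫ = (1 - p) * k) (hC : ⟪v, C - O⟫ = -M * k) :
    MeasureTheory.volume (halfPart (triangleRegion A B C) O v) =
      MeasureTheory.volume (triangleRegion A B C) / 2 := by
  rw [triangleRegion_swap B A C]
  rw [volume_halfPart_eq_half_iff hne.comm_left (by rw [hB]; exact mul_pos (by linarith) hk)
      (by rw [hA]; have := mul_nonneg hp0 hk.le; linarith)
      (by rw [hC]; have := mul_nonneg hM0 hk.le; linarith), hA, hB, hC]
  linear_combination -k ^ 2 * hM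

theorem ENNReal_half_sub_quarter {a b : ENNReal} (ha : a ≠ ⊤) (h : a / 4 + b = a / 2) :
    b = a / 4 := by
  rw [← ENNReal_quarter_add_quarter] at h
  exact (ENNReal.add_right_inj (ENNReal.div_ne_top ha (by norm_num))).1 h

theorem ENNReal_sub_half {a b : ENNReal} (ha : a ≠ ⊤) (h : a / 2 + b = a) : b = a / 2 := by
  nth_rewrite 2 [← ENNReal.add_halves a] at h
  exact (ENNReal.add_right_inj (ENNReal.div_ne_top ha (by norm_num))).1 h

theorem volume_halfPart_neg (T : Set Plane) {O v : Plane} (hv : v ≠ 0) :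
    MeasureTheory.volume (halfPart T O v) + MeasureTheory.volume (halfPart T O (-v)) =
      MeasureTheory.volume T := by
  have hmeas : MeasurableSet {Z : Plane | ⟪v, Z - O⟫ < 0} :=
    (isOpen_lt (continuous_inner_sub v O) continuous_const).measurableSet
  rw [← MeasureTheory.measure_sdiff_add_inter T hmeas]
  congr 1
  · congr 1
    ext Z
    simp [halfPart]
  · apply le_antisymm
    · calc MeasureTheory.volume (halfPart T O (-v))
          ≤ MeasureTheory.volume (T ∩ {Z | ⟪v, Z - O⟫ < 0} ∪ {Z | ⟪v, Z - O⟫ = 0}) := by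
            apply MeasureTheory.measure_mono
            rintro Z ⟨hZ, h⟩
            rw [inner_neg_left] at h
            rcases (neg_nonneg.1 h).lt_or_eq with h | h
            · exact Or.inl ⟨hZ, h⟩
            · exact Or.inr h
        _ ≤ _ := by
            refine (MeasureTheory.measure_union_le _ _).trans ?_
            rw [volume_line O hv, add_zero]
    · apply MeasureTheory.measure_mono
      rintro Z ⟨hZ, h⟩
      refine ⟨hZ, ?_⟩
      rw [inner_neg_left]
      exact neg_nonneg.2 (le_of_lt h)

/-- Two orthogonal bisecting lines of which one quadrant cuts off a quarter form a cross. -/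
theorem isCross_of_halves {T : Set Plane} (hT : MeasurableSet T)
    (hTtop : MeasureTheory.volume T ≠ ⊤) {O u v : Plane} (hu : u ≠ 0) (hv : v ≠ 0)
    (huv : ⟪u, v⟫ = 0)
    (h₁ : MeasureTheory.volume (halfPart T O u) = MeasureTheory.volume T / 2)
    (h₂ : MeasureTheory.volume (halfPart T O v) = MeasureTheory.volume T / 2)
    (h : MeasureTheory.volume (T ∩ quadrant O u v) = MeasureTheory.volume T / 4) :
    IsCross T O u v := by
  have hnv : MeasureTheory.volume (T ∩ quadrant O (-u) v) = MeasureTheory.volume T / 4 := by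
    apply ENNReal_half_sub_quarter hTtop
    rw [← h, ← volume_halfPart hT hu hv, h₂]
  have hun : MeasureTheory.volume (T ∩ quadrant O u (-v)) = MeasureTheory.volume T / 4 := by
    apply ENNReal_half_sub_quarter hTtop
    rw [← h, quadrant_comm O u v, quadrant_comm O u (-v), ← volume_halfPart hT hv hu, h₁]
  have hnn : MeasureTheory.volume (T ∩ quadrant O (-u) (-v)) = MeasureTheory.volume T / 4 := by
    apply ENNReal_half_sub_quarter hTtop
    rw [← hun, ← volume_halfPart hT hu (neg_ne_zero.2 hv)]
    apply ENNReal_sub_half hTtop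
    rw [← h₂, volume_halfPart_neg T hv]
  refine ⟨hu, hv, huv, fun i j => ?_⟩
  rcases Int.units_eq_one_or i with rfl | rfl <;> rcases Int.units_eq_one_or j with rfl | rfl <;>
    simpa

/-- Orthogonal parameters give a quadrisection with a triangular part on `AB`. -/
theorem IsQuarter.isQuadrisectionOn {A B C : Plane} (hABC : AffineIndependent ℝ ![A, B, C])
    {x z : ℝ} (h : IsQuarter x z) (hperp : ⟪leftArm A B C x z, rightArm A B C x z⟫ = 0) :
    IsQuadrisectionOn (triangleRegion A B C) A B (quarterPair A B C x z) := by
  set T := triangleRegion A B C with hTdef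
  set O := quarterApex A B C x z with hO
  set X := barycentric A B C (1 - x) 0 with hX
  set Y := barycentric A B C z 0 with hY
  have hT : Convex ℝ T := convex_triangleRegion A B C
  have hTc : IsCompact T := isCompact_triangleRegion A B C
  have hT0 : MeasureTheory.volume T ≠ 0 := volume_triangleRegion_ne_zero hABC
  have hTtop : MeasureTheory.volume T ≠ ⊤ := volume_triangleRegion_ne_top A B C
  obtain ⟨c, hc⟩ : ∃ c, c = 1 / (4 * (x + z - 1)) := ⟨_, rfl⟩
  obtain ⟨b, hb⟩ : ∃ b, b = 1 - x + c * (2 * x ^ 2 - 1) := ⟨_, rfl⟩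
  have hObc : O = barycentric A B C b c := by rw [hO, quarterApex, hb, hc]
  have hx1 := h.left_le
  have hz1 := h.right_le
  have hpq : 1 - x < z := by linarith [h.lt_add]
  have hx0 : 0 < x := by linarith
  have hz0 : 0 < z := by linarith
  have hx2 := h.swap.le_two_mul_right_sq
  have hz2 := h.le_two_mul_right_sq
  have hu0 : 0 < x + z - 1 := by linarith
  have hc0 : 0 < c := by
    rw [hc]
    positivity
  have hcu : c * (x + z - 1) = 1 / 4 := by
    rw [hc]
    field_simp
  have hzb : z - b = c * (2 * z ^ 2) := by
    rw [hb, hc]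
    exact h.sub_eq
  have hb0 : 0 ≤ b := by
    have := mul_nonneg hc0.le (sub_nonneg.2 hx2)
    linarith
  have hbc : b + c ≤ 1 := by
    have := mul_nonneg hc0.le (sub_nonneg.2 hz2)
    linarith
  have hcr : cross (B - A) (C - A) ≠ 0 := affineIndependent_iff_cross_ne_zero.1 hABC
  have haff : AffineIndependent ℝ ![X, Y, O] := by
    rw [affineIndependent_iff_cross_ne_zero, hX, hY, hObc, barycentric_sub, barycentric_sub,
      cross_combo]
    apply mul_ne_zero _ hcr
    have : (z - (1 - x)) * (c - 0) - (0 - 0) * (b - (1 - x)) = 1 / 4 := by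
      linear_combination hcu
    rw [this]
    norm_num
  have hXO : X - O ≠ 0 := sub_ne_zero.2 fun heq =>
    absurd (haff.injective (show ![X, Y, O] 0 = ![X, Y, O] 2 from heq)) (by decide)
  have hYO : Y - O ≠ 0 := sub_ne_zero.2 fun heq =>
    absurd (haff.injective (show ![X, Y, O] 1 = ![X, Y, O] 2 from heq)) (by decide)
  change ⟪X - O, Y - O⟫ = 0 at hperp
  have hperp' : ⟪Y - O, X - O⟫ = 0 := by rw [real_inner_comm, hperp]
  have hpart : closedPart T O (X - O) (Y - O) = triangleRegion X Y O :=
    closedPart_triangleRegion (sub_nonneg.2 hx1) hpq hz1 hb0 hc0 hbc hX hY hObc hXO hYO hperp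
  have hquad : MeasureTheory.volume (T ∩ quadrant O (X - O) (Y - O)) =
      MeasureTheory.volume T / 4 := by
    rw [← volume_closedPart hXO hYO, hpart, hX, hY, hObc, volume_barycentric]
    have := ofReal_mul_eq_div_iff (n := 4) (r := |(z - (1 - x)) * c|) hT0 hTtop (by norm_num)
    push_cast at this
    rw [this, show (z - (1 - x)) * c = 1 / 4 by linear_combination hcu]
    norm_num
  have hf : ∀ r w, ⟪w, barycentric A B C r 0 - O⟫ =
      (1 - r) * ⟪w, A - O⟫ + r * ⟪w, B - O⟫ := by
    intro r w
    rw [inner_barycentric]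
    ring
  have hfO : ∀ w, (1 - b - c) * ⟪w, A - O⟫ + b * ⟪w, B - O⟫ + c * ⟪w, C - O⟫ = 0 := by
    intro w
    rw [← inner_barycentric, ← hObc, sub_self, inner_zero_right]
  have hYY : 0 < ⟪Y - O, Y - O⟫ := real_inner_self_pos.2 hYO
  have hXX : 0 < ⟪X - O, X - O⟫ := real_inner_self_pos.2 hXO
  have f1 := hf (1 - x) (Y - O)
  have f2 := hf z (Y - O)
  have f3 := hfO (Y - O)
  have g1 := hf (1 - x) (X - O)
  have g2 := hf z (X - O)
  have g3 := hfO (X - O)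
  rw [← hX] at f1 g1
  rw [← hY] at f2 g2
  rw [hperp'] at f1
  rw [hperp] at g2
  -- The line `XO` cuts off `B`, with slope `2 * x² - x`, which is nonnegative since `x ≤ 1 ≤ 2 *
  -- x²`.
  have h₂ : MeasureTheory.volume (halfPart T O (Y - O)) = MeasureTheory.volume T / 2 := by
    apply volume_halfPart_of_slope hABC (p := 1 - x) (k := ⟪Y - O, Y - O⟫ / (x + z - 1))
      (M := 2 * x ^ 2 - x) (sub_nonneg.2 hx1) (by linarith) (by positivity) (by linarith) (by ring)
    · rw [mul_div_assoc', eq_div_iff hu0.ne']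
      linear_combination (1 - x) * f2 - z * f1
    · rw [mul_div_assoc', eq_div_iff hu0.ne']
      linear_combination -x * f2 + (1 - z) * f1
    · rw [mul_div_assoc', eq_div_iff hu0.ne']
      apply mul_left_cancel₀ hc0.ne'
      linear_combination (x + z - 1) * f3 + (b * x - (1 - b - c) * (1 - x)) * f2
        - (b * (1 - z) - (1 - b - c) * z) * f1 - ⟪Y - O, Y - O⟫ * hb
  have h₁ : MeasureTheory.volume (halfPart T O (X - O)) = MeasureTheory.volume T / 2 := by
    rw [hTdef, triangleRegion_swap B A C]
    apply volume_halfPart_of_slope hABC.comm_left (p := 1 - z)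
      (k := ⟪X - O, X - O⟫ / (x + z - 1))
      (M := 2 * z ^ 2 - z) (sub_nonneg.2 hz1) (by linarith) (by positivity) (by linarith) (by ring)
    · rw [mul_div_assoc', eq_div_iff hu0.ne']
      linear_combination (1 - z) * g1 - x * g2
    · rw [mul_div_assoc', eq_div_iff hu0.ne']
      linear_combination -z * g1 + (1 - x) * g2
    · rw [mul_div_assoc', eq_div_iff hu0.ne']
      apply mul_left_cancel₀ hc0.ne'
      linear_combination (x + z - 1) * g3 + ((1 - b - c) * z - b * (1 - z)) * g1
        - ((1 - b - c) * (1 - x) - b * x) * g2 - ⟪X - O, X - O⟫ * hzb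
  have hcross : IsCross T O (X - O) (Y - O) :=
    isCross_of_halves hTc.measurableSet hTtop hXO hYO hperp h₁ h₂ hquad
  refine ⟨_, _, rfl, hcross.isQuadrisectingPair hTc hT hT0, T ∩ quadrant O (X - O) (Y - O), ?_,
    X, Y, O, haff, ?_, barycentric_mem_segment (sub_nonneg.2 hx1) (by linarith),
    barycentric_mem_segment hz0.le hz1⟩
  · have := hcross.regions_eq hT hT0
    change _ ∈ regions T (cut T O (Y - O)) (cut T O (X - O))
    rw [this]
    exact ⟨(1, 1), by simp⟩
  · rw [closure_inter_quadrant hTc.isClosed hT (by simpa using hcross.nonempty hT0 1 1), hpart]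

theorem theorem2 (A B C : Plane) (hABC : AffineIndependent ℝ ![A, B, C])
    (hBC : dist B C < dist A B) (hAC : dist A B < dist A C) :
    (∃! q : Sym2 (Set Plane), IsQuadrisectionOn (triangleRegion A B C) A B q) ∧
    ¬ ∃ q : Sym2 (Set Plane), IsQuadrisectionOn (triangleRegion A B C) A C q := by
  have h1 : dist B C ^ 2 < dist A B ^ 2 := by gcongr
  have h2 : dist A B ^ 2 < dist A C ^ 2 := by gcongr
  have h0 : 0 < dist A B ^ 2 := lt_of_le_of_lt (sq_nonneg _) h1
  constructor
  · obtain ⟨x, z, hq, he⟩ := exists_isQuarter h1 h2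
    refine ⟨quarterPair A B C x z,
      hq.isQuadrisectionOn hABC ((hq.inner_arms_eq_zero_iff A B C).2 he), fun q hq' => ?_⟩
    obtain ⟨x', z', hq'', hperp, rfl⟩ := hq'.exists_quarterPair hABC
    obtain ⟨rfl, rfl⟩ := hq.unique hq'' h1 h0 he ((hq''.inner_arms_eq_zero_iff A B C).1 hperp)
    rfl
  · rintro ⟨q, hq⟩
    -- Exchanging the labels `B` and `C` makes the longest side the base.
    have hT : triangleRegion A B C = triangleRegion A C B := by
      rw [triangleRegion, triangleRegion, Set.pair_comm]
    rw [hT] at hq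
    obtain ⟨x, z, hq', hperp, -⟩ := hq.exists_quarterPair hABC.comm_right
    have he := (hq'.inner_arms_eq_zero_iff A C B).1 hperp
    rw [dist_comm C B] at he
    exact hq'.false_of_longest (h1.trans h2) h2 (h0.trans h2) he
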